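/- Let $E$ be a finite or countably infinite set, identified with the standard orthonormal basis of the real or complex Hilbert space $\ell^2(E)$, and let $H$ be a closed subspace of $\ell^2(E)$. For a closed subspace $L$ let $P_L$ denote the orthogonal projection onto $L$, and for $F \subseteq E$ let $[F]$ be the closed linear span of $F$ in $\ell^2(E)$. Let ${\bf P}^H$ be the determinantal probability measure on $2^E$ associated with $H$, that is, the unique probability measure (on the product $\sigma$-field) whose random set $S \subseteq E$ satisfies $${\bf P}^H[A \subseteq S] = \det\big[\langle P_H e, e'\rangle\big]_{e, e' \in A} \quad \text{for all finite } A \subseteq E,$$ and let $\mathrm{Var}^H$ denote variance with respect to ${\bf P}^H$. For $K \subseteq E$ let ${\cal F}(K)$ be the $\sigma$-field on $2^E$ generated by the events $\{e \in S\}$, $e \in K$. Let $F$ and $K$ be disjoint subsets of $E$ with $K$ finite. Then for every $C \subseteq K$, $$\mathrm{Var}^H\big({\bf P}^H[S \cap K = C \mid {\cal F}(F)]\big) \le |K| \sum_{e \in K} \|P_{[F]} P_H e\|^2 .$$ Moreover, if $A_1 \in {\cal F}(K)$ and $A_2 \in {\cal F}(F)$, then $$\big|{\bf P}^H(A_1 \cap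 A_2) - {\bf P}^H(A_1)\,{\bf P}^H(A_2)\big| \le \Big(2^{|K|}\, |K| \sum_{e \in K} \|P_{[F]} P_H e\|^2\Big)^{1/2} .$$ -/

import Mathlib

open MeasureTheory ProbabilityTheory Filter Topology

section

open scoped ComplexOrder

/-- The matrix whose rows indexed by `s` are those of `Q`, and whose other rows are those
of `1 - Q`. -/
def Determinantal.mix {𝕜 n : Type*} [RCLike 𝕜] [DecidableEq n] (Q : Matrix n n 𝕜)
    (s : Finset n) : Matrix n n 𝕜 :=
  Matrix.of fun i j => if i ∈ s then Q i j else (1 - Q) i j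

theorem Determinantal.det_piecewise_nonneg_of_posDef {𝕜 n : Type*} [RCLike 𝕜] [Fintype n]
    [DecidableEq n] {Q : Matrix n n 𝕜} (hQ : Q.PosDef) (hQ' : (1 - Q).PosSemidef) (s : Finset n) :
    0 ≤ (mix Q s).det := by
  set D : Matrix n n 𝕜 := Matrix.diagonal fun i => if i ∈ s then 1 else 0 with hD
  set T : Matrix n n 𝕜 := Matrix.diagonal fun i => if i ∈ s then 0 else 1 with hT
  have hDT : D * T = 0 := by
    rw [hD, hT, Matrix.diagonal_mul_diagonal, ← Matrix.diagonal_zero]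
    congr 1; ext i; split_ifs <;> simp
  have hDD : D * D = D := by
    rw [hD, Matrix.diagonal_mul_diagonal]; congr 1; ext i; split_ifs <;> simp
  have hsum : D + T = 1 := by
    rw [hD, hT, Matrix.diagonal_add, ← Matrix.diagonal_one]
    congr 1; ext i; split_ifs <;> simp
  have hTH : T.conjTranspose = T := by
    rw [hT, Matrix.diagonal_conjTranspose]; congr 1; ext i; simp [apply_ite]
  have hDp : D.PosSemidef := by
    rw [hD, Matrix.posSemidef_diagonal_iff]; intro i; split_ifs <;> simp
  have hu : IsUnit Q.det := (Matrix.isUnit_iff_isUnit_det Q).1 hQ.isUnit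
  have hQQ : Q⁻¹ * Q = 1 := Matrix.nonsing_inv_mul Q hu
  have hQQ' : Q * Q⁻¹ = 1 := Matrix.mul_nonsing_inv Q hu
  have hH : Q.conjTranspose = Q := hQ.isHermitian
  set R : Matrix n n 𝕜 := Q⁻¹ - 1 with hR
  have hRp : R.PosSemidef := by
    have h1 : (Q * (1 - Q) * Q + (1 - Q) * Q * (1 - Q)).PosSemidef := by
      refine Matrix.PosSemidef.add ?_ ?_
      · simpa [hH] using hQ'.mul_mul_conjTranspose_same Q
      · have := hQ.posSemidef.mul_mul_conjTranspose_same (1 - Q)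
        rwa [Matrix.conjTranspose_sub, hH, Matrix.conjTranspose_one] at this
    have h2 := h1.mul_mul_conjTranspose_same Q⁻¹
    rw [Matrix.conjTranspose_nonsing_inv, hH] at h2
    have h3 : Q * (1 - Q) * Q + (1 - Q) * Q * (1 - Q) = Q * (Q⁻¹ - 1) * Q := by
      have : Q * (Q⁻¹ - 1) * Q = (Q * Q⁻¹) * Q - Q * Q := by noncomm_ring
      rw [this, hQQ']; noncomm_ring
    rw [h3] at h2
    have h4 : Q⁻¹ * (Q * (Q⁻¹ - 1) * Q) * Q⁻¹ = (Q⁻¹ * Q) * (Q⁻¹ - 1) * (Q * Q⁻¹) := by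
      noncomm_ring
    rwa [h4, hQQ, hQQ', one_mul, mul_one] at h2
  have hM : mix Q s = ((D + T * R) * Q : Matrix n n 𝕜) := by
    have : (D + T * R) * Q = D * Q + T * (1 - Q) := by
      have : (D + T * R) * Q = D * Q + T * (Q⁻¹ * Q - Q) := by rw [hR]; noncomm_ring
      rw [this, hQQ]
    rw [this]
    ext i j
    simp only [hD, hT, Matrix.add_apply, Matrix.diagonal_mul, mix, Matrix.of_apply]
    by_cases hi : i ∈ s <;> simp [hi]
  have hf : D + T * R = (1 + T * R * D) * (D + T * R * T) := by
    have : (1 + T * R * D) * (D + T * R * T)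
        = D + T * R * T + T * R * (D * D) + T * R * (D * T) * R * T := by noncomm_ring
    rw [this, hDD, hDT]
    have : T * R = T * R * (D + T) := by rw [hsum, mul_one]
    nth_rewrite 1 [this]
    noncomm_ring
  have h1 : Matrix.det (1 + T * R * D) = 1 := by
    rw [mul_assoc, Matrix.det_one_add_mul_comm]
    rw [mul_assoc, hDT]; simp
  have h2 : (D + T * R * T).PosSemidef := by
    refine hDp.add ?_
    have := hRp.mul_mul_conjTranspose_same T
    rwa [hTH] at this
  rw [hM, Matrix.det_mul, hf, Matrix.det_mul, h1, one_mul]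
  exact mul_nonneg h2.det_nonneg hQ.posSemidef.det_nonneg

theorem Determinantal.det_piecewise_nonneg {𝕜 n : Type*} [RCLike 𝕜] [Fintype n]
    [DecidableEq n] {Q : Matrix n n 𝕜} (hQ : Q.PosSemidef) (hQ' : (1 - Q).PosSemidef)
    (s : Finset n) :
    0 ≤ (mix Q s).det := by
  let P : ℝ → Matrix n n 𝕜 := fun t => ((1 - t : ℝ) : 𝕜) • Q + (t : 𝕜) • 1
  have hP : Continuous P := by fun_prop
  have hc : Continuous fun t => (mix (P t) s).det := by
    refine Continuous.matrix_det ?_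
    refine continuous_matrix fun i j => ?_
    by_cases hi : i ∈ s
    · simpa only [mix, Matrix.of_apply, hi, if_true] using hP.matrix_elem i j
    · simp only [mix, Matrix.of_apply, hi, if_false, Matrix.sub_apply]
      exact continuous_const.sub (hP.matrix_elem i j)
  have h0 : P 0 = Q := by simp [P]
  have hlim := (hc.tendsto 0).mono_left (nhdsWithin_le_nhds (s := Set.Ioi 0))
  simp only [h0] at hlim
  refine ge_of_tendsto hlim ?_
  filter_upwards [Ioo_mem_nhdsGT (zero_lt_one' ℝ)] with t ht
  refine Determinantal.det_piecewise_nonneg_of_posDef ?_ ?_ s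
  · refine Matrix.PosDef.posSemidef_add ?_ ?_
    · exact hQ.smul (RCLike.ofReal_nonneg.2 (sub_nonneg.2 ht.2.le))
    · exact Matrix.PosDef.one.smul (by simpa using ht.1)
  · have : 1 - P t = ((1 - t : ℝ) : 𝕜) • (1 - Q) := by
      simp only [P]; push_cast; module
    rw [this]
    exact hQ'.smul (RCLike.ofReal_nonneg.2 (sub_nonneg.2 ht.2.le))

theorem Determinantal.sum_det_piecewise {𝕜 n : Type*} [RCLike 𝕜] [Fintype n]
    [DecidableEq n] (Q : Matrix n n 𝕜) (A : Finset n) :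
    ∑ s : Finset n, (if A ⊆ s then (mix Q s).det else 0)
      = (Q.submatrix ((↑) : A → n) (↑)).det := by
  let m' : Matrix n n 𝕜 := Matrix.of fun i j => if i ∈ A then 0 else (1 - Q) i j
  have h := (Matrix.detRowAlternating (R := 𝕜) (n := n)).toMultilinearMap.map_add_univ Q m'
  have h1 : ∀ s : Finset n, (Matrix.detRowAlternating (R := 𝕜) (n := n)).toMultilinearMap
      (s.piecewise Q m') =
      if A ⊆ s then (mix Q s).det else 0 := by
    intro s
    change Matrix.det (Matrix.of (s.piecewise Q m')) = _
    split_ifs with hA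
    · congr 1
      ext i j
      by_cases hi : i ∈ s
      · simp [Finset.piecewise, hi, mix]
      · have : i ∉ A := fun h => hi (hA h)
        simp [Finset.piecewise, hi, m', this, mix]
    · obtain ⟨i, hiA, his⟩ := Finset.not_subset.1 hA
      refine Matrix.det_eq_zero_of_row_eq_zero i fun j => ?_
      simp [Finset.piecewise, his, m', hiA]
  rw [← Finset.sum_congr rfl fun s _ => h1 s, ← h]
  change Matrix.det (Q + m') = _
  rw [Matrix.twoBlockTriangular_det (Q + m') (fun i => i ∈ A)]
  · have e1 : Matrix.toSquareBlockProp (Q + m') (fun i => i ∈ A)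
        = Q.submatrix ((↑) : A → n) (↑) := by
      ext i j
      have := i.2
      simp [Matrix.toSquareBlockProp, m', this]
    have e2 : Matrix.toSquareBlockProp (Q + m') (fun i => ¬ i ∈ A) = 1 := by
      ext i j
      have := i.2
      simp [Matrix.toSquareBlockProp, m', this, Matrix.one_apply, Subtype.ext_iff]
    rw [e2, Matrix.det_one, mul_one, e1]
    congr!
  · intro i hi j hj
    have : i ≠ j := by rintro rfl; exact hi hj
    simp [m', hi, this]

/-- `P` is a determinantal probability measure on `2^E` with kernel `Q`: the probability that the
random set contains a given finite set `A` is the principal minor of `Q` indexed by `A`. -/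
def IsDeterminantal {𝕜 E : Type*} [RCLike 𝕜] [DecidableEq E] (Q : Matrix E E 𝕜) (P : Measure (Set E)) : Prop :=
  IsProbabilityMeasure P ∧
    ∀ A : Finset E, ((P.real {B : Set E | (A : Set E) ⊆ B} : ℝ) : 𝕜) =
      Matrix.det (Matrix.of fun i j : A => Q i j)

theorem Determinantal.exists_finite_approx {𝕜 E : Type*} [RCLike 𝕜] [DecidableEq E] (Q : Matrix E E 𝕜)
    (h0 : ∀ J : Finset E, (Matrix.of fun i j : J => Q i j).PosSemidef)
    (h1 : ∀ J : Finset E, (1 - Matrix.of fun i j : J => Q i j).PosSemidef) (J : Finset E) :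
    ∃ ν : ProbabilityMeasure (E → Bool), ∀ A : Finset E, A ⊆ J →
      (ν : Measure (E → Bool)) {f | ∀ e ∈ A, f e = true} =
        ENNReal.ofReal (RCLike.re (Matrix.det (Matrix.of fun i j : A => Q i j))) := by
  set M : Matrix J J 𝕜 := Matrix.of fun i j : J => Q i j with hM
  let x : Finset J → E → Bool := fun s e => decide (∃ h : e ∈ J, (⟨e, h⟩ : J) ∈ s)
  let ν : Measure (E → Bool) :=
    ∑ s : Finset J, ENNReal.ofReal (RCLike.re (Determinantal.mix M s).det) • Measure.dirac (x s)
  have key : ∀ A : Finset E, A ⊆ J → ν {f | ∀ e ∈ A, f e = true} =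
        ENNReal.ofReal (RCLike.re (Matrix.det (Matrix.of fun i j : A => Q i j))) := by
    intro A hA
    have hmeas : MeasurableSet {f : E → Bool | ∀ e ∈ A, f e = true} := by
      have : {f : E → Bool | ∀ e ∈ A, f e = true} = ⋂ e ∈ A, (fun f => f e) ⁻¹' {true} := by
        ext f; simp
      rw [this]
      exact A.measurableSet_biInter fun e _ => measurable_pi_apply e (measurableSet_singleton _)
    let A' : Finset J := Finset.univ.filter fun e => (e : E) ∈ A
    have hmem : ∀ s : Finset J, x s ∈ {f : E → Bool | ∀ e ∈ A, f e = true} ↔ A' ⊆ s := by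
      intro s
      simp only [x, Set.mem_ofPred_eq, decide_eq_true_eq, A', Finset.subset_iff,
        Finset.mem_filter, Finset.mem_univ, true_and]
      constructor
      · intro h e he
        obtain ⟨_, h2⟩ := h e he
        exact h2
      · intro h e he
        exact ⟨hA he, h he⟩
    have hdet : (M.submatrix ((↑) : A' → J) (↑)).det
        = Matrix.det (Matrix.of fun i j : A => Q i j) := by
      let e : A ≃ A' :=
        { toFun := fun a => ⟨⟨a, hA a.2⟩, by simp [A']⟩
          invFun := fun a => ⟨a.1.1, by simpa [A'] using a.2⟩
          left_inv := fun a => rfl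
          right_inv := fun a => rfl }
      rw [← Matrix.det_submatrix_equiv_self e]
      rfl
    have hs := Determinantal.sum_det_piecewise M A'
    rw [hdet] at hs
    rw [← hs, map_sum, ENNReal.ofReal_sum_of_nonneg]
    · simp only [ν, Measure.coe_finsetSum, Finset.sum_apply, Measure.smul_apply, smul_eq_mul,
        Measure.dirac_apply' _ hmeas]
      refine Finset.sum_congr rfl fun s _ => ?_
      by_cases h : A' ⊆ s
      · rw [Set.indicator_of_mem ((hmem s).2 h)]; simp [h]
      · rw [Set.indicator_of_notMem (fun h' => h ((hmem s).1 h'))]; simp [h]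
    · intro s _
      split_ifs
      · exact (RCLike.nonneg_iff.1 (Determinantal.det_piecewise_nonneg (h0 J) (h1 J) s)).1
      · simp
  have hν : IsProbabilityMeasure ν := by
    constructor
    have := key ∅ (by simp)
    simpa using this
  exact ⟨⟨ν, hν⟩, key⟩

theorem IsDeterminantal.exists_of_posSemidef {𝕜 E : Type*} [RCLike 𝕜] [DecidableEq E] [Countable E]
    (Q : Matrix E E 𝕜)
    (h0 : ∀ J : Finset E, (Matrix.of fun i j : J => Q i j).PosSemidef)
    (h1 : ∀ J : Finset E, (1 - Matrix.of fun i j : J => Q i j).PosSemidef) :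
    ∃ P : Measure (Set E), IsDeterminantal Q P := by
  choose ν hν using Determinantal.exists_finite_approx Q h0 h1
  let U : Ultrafilter (Finset E) := Ultrafilter.of atTop
  let μ : ProbabilityMeasure (E → Bool) := (U.map ν).lim
  have hμ : Tendsto ν U (𝓝 μ) := (U.map ν).le_nhds_lim
  have hval : ∀ A : Finset E, (μ : Measure (E → Bool)) {f | ∀ e ∈ A, f e = true} =
      ENNReal.ofReal (RCLike.re (Matrix.det (Matrix.of fun i j : A => Q i j))) := by
    intro A
    have hclo : IsClopen {f : E → Bool | ∀ e ∈ A, f e = true} := by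
      have : {f : E → Bool | ∀ e ∈ A, f e = true} = ⋂ e ∈ A, (fun f => f e) ⁻¹' {true} := by
        ext f; simp
      rw [this]
      exact isClopen_biInter_finset fun e _ =>
        (isClopen_discrete {true}).preimage (continuous_apply e)
    have ht := ProbabilityMeasure.tendsto_measure_of_null_frontier_of_tendsto' hμ
      (E := {f : E → Bool | ∀ e ∈ A, f e = true}) (by simp [hclo.frontier_eq])
    refine tendsto_nhds_unique ht (tendsto_const_nhds.congr' ?_)
    have : ∀ᶠ J in (atTop : Filter (Finset E)), A ⊆ J := eventually_ge_atTop A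
    filter_upwards [Ultrafilter.of_le atTop this] with J hJ
    exact (hν J A hJ).symm
  let g : (E → Bool) → Set E := fun f => {e | f e = true}
  have hg : Measurable g := by
    refine measurable_set_iff.2 fun e => ?_
    have : MeasurableSet {f : E → Bool | e ∈ g f} :=
      measurable_pi_apply (X := fun _ : E => Bool) e (measurableSet_singleton true)
    exact measurableSet_setOfPred.1 this
  refine ⟨(μ : Measure (E → Bool)).map g, Measure.isProbabilityMeasure_map hg.aemeasurable, ?_⟩
  intro A
  have hms : MeasurableSet {B : Set E | (A : Set E) ⊆ B} := by
    have : {B : Set E | (A : Set E) ⊆ B} = ⋂ e ∈ A, {B : Set E | e ∈ B} := by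
      ext B; simp [Set.subset_def]
    rw [this]
    exact A.measurableSet_biInter fun e _ => measurableSet_mem e
  have hpre : g ⁻¹' {B : Set E | (A : Set E) ⊆ B} = {f | ∀ e ∈ A, f e = true} := by
    ext f; simp [g, Set.subset_def]
  have hdet := (h0 A).det_nonneg
  rw [Measure.real, Measure.map_apply hg hms, hpre, hval,
    ENNReal.toReal_ofReal (RCLike.nonneg_iff.1 hdet).1]
  exact RCLike.conj_eq_iff_re.1 (RCLike.conj_eq_iff_im.2 (RCLike.nonneg_iff.1 hdet).2)

theorem IsDeterminantal.unique {𝕜 E : Type*} [RCLike 𝕜] [DecidableEq E] [Countable E] {Q : Matrix E E 𝕜}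
    {P P' : Measure (Set E)} (h : IsDeterminantal Q P) (h' : IsDeterminantal Q P') : P = P' := by
  obtain ⟨hp, h⟩ := h
  obtain ⟨hp', h'⟩ := h'
  refine ext_of_generate_finite (Set.range fun A : Finset E => {B : Set E | (A : Set E) ⊆ B})
    ?_ ?_ ?_ (by simp)
  · refine le_antisymm ?_ ?_
    · have : @Measurable (Set E) (Set E) (MeasurableSpace.generateFrom
          (Set.range fun A : Finset E => {B : Set E | (A : Set E) ⊆ B})) _ id := by
        refine (@measurable_set_iff _ _ (_) _).2 fun e => ?_
        refine (@measurableSet_setOfPred _ (_) _).1 ?_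
        refine MeasurableSpace.measurableSet_generateFrom ⟨{e}, ?_⟩
        ext B; simp
      exact fun s hs => this hs
    · refine MeasurableSpace.generateFrom_le ?_
      rintro _ ⟨A, rfl⟩
      have : {B : Set E | (A : Set E) ⊆ B} = ⋂ e ∈ A, {B : Set E | e ∈ B} := by
        ext B; simp [Set.subset_def]
      simp only
      rw [this]
      exact A.measurableSet_biInter fun e _ => measurableSet_mem e
  · rintro _ ⟨A, rfl⟩ _ ⟨A', rfl⟩ _
    refine ⟨A ∪ A', ?_⟩
    ext B; simp
  · rintro _ ⟨A, rfl⟩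
    have := (h A).trans (h' A).symm
    exact (measureReal_eq_measureReal_iff).1 (RCLike.ofReal_injective this)

/-- `ℓ²(E)` over the scalars `𝕜` (which is `ℝ` or `ℂ`). -/
abbrev L2 (𝕜 E : Type*) [RCLike 𝕜] : Type _ := lp (fun _ : E => 𝕜) 2

/-- The standard orthonormal basis vector of `ℓ²(E)` attached to `e`. -/
noncomputable def stdVec (𝕜 : Type*) {E : Type*} [RCLike 𝕜] [DecidableEq E] (e : E) : L2 𝕜 E :=
  lp.single 2 e 1

/-- The orthogonal projection of `ℓ²(E)` onto a closed subspace `H`. -/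
noncomputable def proj {𝕜 E : Type*} [RCLike 𝕜] (H : ClosedSubmodule 𝕜 (L2 𝕜 E)) :
    L2 𝕜 E →L[𝕜] L2 𝕜 E :=
  haveI : CompleteSpace H.toSubmodule := H.isClosed.completeSpace_coe
  H.toSubmodule.starProjection

/-- The closed linear span `[F]` of the basis vectors attached to the elements of `F`. -/
noncomputable def coordSubspace (𝕜 : Type*) {E : Type*} [RCLike 𝕜] [DecidableEq E] (F : Set E) :
    ClosedSubmodule 𝕜 (L2 𝕜 E) :=
  (Submodule.span 𝕜 (stdVec 𝕜 '' F)).closure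

/-- The matrix of the orthogonal projection onto `H` in the standard basis of `ℓ²(E)`. -/
noncomputable def projMatrix {𝕜 E : Type*} [RCLike 𝕜] [DecidableEq E]
    (H : ClosedSubmodule 𝕜 (L2 𝕜 E)) : Matrix E E 𝕜 :=
  Matrix.of fun i j => inner 𝕜 (stdVec 𝕜 i) (proj H (stdVec 𝕜 j))

theorem exists_isDeterminantal_projMatrix {𝕜 E : Type*} [RCLike 𝕜] [DecidableEq E] [Countable E]
    (H : ClosedSubmodule 𝕜 (L2 𝕜 E)) : ∃ P : Measure (Set E), IsDeterminantal (projMatrix H) P := by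
  have : CompleteSpace H.toSubmodule := H.isClosed.completeSpace_coe
  have hstd : ∀ i j : E, inner 𝕜 (stdVec 𝕜 i) (stdVec 𝕜 j) = if i = j then 1 else 0 := by
    intro i j
    rw [stdVec, lp.inner_single_left]
    by_cases h : i = j
    · subst h; simp [stdVec]
    · simp [stdVec, h]
  refine IsDeterminantal.exists_of_posSemidef _ (fun J => ?_) (fun J => ?_)
  · have : (Matrix.of fun i j : J => projMatrix H i j)
        = Matrix.gram 𝕜 fun i : J => H.toSubmodule.starProjection (stdVec 𝕜 (i : E)) := by
      ext i j
      simp only [projMatrix, Matrix.of_apply, Matrix.gram_apply, proj]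
      rw [Submodule.inner_starProjection_left_eq_right]
      congr 1
      exact (Submodule.starProjection_eq_self_iff.2
        (Submodule.starProjection_apply_mem _ _)).symm
    rw [this]
    exact Matrix.posSemidef_gram 𝕜 _
  · have : (1 - Matrix.of fun i j : J => projMatrix H i j)
        = Matrix.gram 𝕜 fun i : J => stdVec 𝕜 (i : E)
            - H.toSubmodule.starProjection (stdVec 𝕜 (i : E)) := by
      ext i j
      have h1 : inner 𝕜 (H.toSubmodule.starProjection (stdVec 𝕜 (i : E)))
          (H.toSubmodule.starProjection (stdVec 𝕜 (j : E)))
          = inner 𝕜 (stdVec 𝕜 (i : E)) (H.toSubmodule.starProjection (stdVec 𝕜 (j : E))) := by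
        rw [Submodule.inner_starProjection_left_eq_right]
        congr 1
        exact Submodule.starProjection_eq_self_iff.2 (Submodule.starProjection_apply_mem _ _)
      simp only [projMatrix, Matrix.of_apply, Matrix.gram_apply, proj, Matrix.sub_apply,
        inner_sub_left, inner_sub_right, h1, hstd]
      rw [Submodule.inner_starProjection_left_eq_right]
      simp [Matrix.one_apply]
    rw [this]
    exact Matrix.posSemidef_gram 𝕜 _

/-- The determinantal probability measure `P^H` on `2^E` associated with a closed subspace `H` of
`ℓ²(E)`: the unique probability measure such that `P^H[A ⊆ S]` is the minor indexed by `A` of the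
matrix of the orthogonal projection onto `H`, for every finite `A ⊆ E`. -/
noncomputable def detMeasure {𝕜 E : Type*} [RCLike 𝕜] [DecidableEq E] [Countable E]
    (H : ClosedSubmodule 𝕜 (L2 𝕜 E)) : Measure (Set E) :=
  Classical.choose (exists_isDeterminantal_projMatrix H)

theorem isDeterminantal_detMeasure {𝕜 E : Type*} [RCLike 𝕜] [DecidableEq E] [Countable E]
    (H : ClosedSubmodule 𝕜 (L2 𝕜 E)) : IsDeterminantal (projMatrix H) (detMeasure H) :=
  Classical.choose_spec (exists_isDeterminantal_projMatrix H)

theorem eq_detMeasure {𝕜 E : Type*} [RCLike 𝕜] [DecidableEq E] [Countable E]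
    {H : ClosedSubmodule 𝕜 (L2 𝕜 E)} {P : Measure (Set E)}
    (hP : IsDeterminantal (projMatrix H) P) : P = detMeasure H :=
  hP.unique (isDeterminantal_detMeasure H)

/-- The `σ`-field `F(K)` on `2^E` generated by the events `{e ∈ S}` for `e ∈ K`. -/
@[reducible] def cylSigma {E : Type*} (K : Set E) : MeasurableSpace (Set E) :=
  MeasurableSpace.generateFrom {s | ∃ e ∈ K, s = {B : Set E | e ∈ B}}

theorem cylSigma_le {E : Type*} (K : Set E) : cylSigma K ≤ Set.instMeasurableSpace := by
  refine MeasurableSpace.generateFrom_le ?_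
  rintro _ ⟨e, _, rfl⟩
  exact measurableSet_mem e

end

/-! Let `Q` be the matrix of `P_H`. On finitely many points, the probability that the trace of `S`
equals `s` is `det (mix Q s)`. Let `F` be finite, let `G` be a finite set disjoint from `F` with `K
⊆ G`, and split the kernel on `F ∪ G` into blocks `A`, `B`, `Bᴴ`, `D`. By a Schur complement, the
law on `G` given trace `T` on `F` has elementary probabilities given by the kernel `R_T = D - Bᴴ (A
- 1_{Tᶜ})⁻¹ B` (`Determinantal.det_mix_fromBlocks`).

Two facts about `R_T` control its fluctuation. Its mean over `T` is `D`
(`Determinantal.sum_det_mix_smul_condKernel`), and the squared norm of row `x` is at most `R_T x x`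
(`Determinantal.rowSq_condKernel_le`). Hence the mean of `‖(R_T - D)_x‖²` is at most `D x x -
‖D_x‖²`. Since `P_H` is a projection, `Q x x = ∑ y, ‖Q x y‖²`, so as `G` grows to the complement of
`F` this bound tends to `∑ y ∈ F, ‖Q x y‖² = ‖P_[F] P_H x‖²`.

Determinants are compared by changing one row at a time. Hadamard's inequality bounds each change by
the norm of the row difference, and Cauchy–Schwarz over the `|K|` rows gives the factor `|K|`
(`Matrix.RowContractive.norm_sub_le`). The same argument for the vector of all `2^|K|` probabilities
at once costs only a factor `2`; the covariance bound needs this.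

Singular kernels are reached by perturbation, infinite `F` by martingale convergence. The covariance
bound then follows by Cauchy–Schwarz over the at most `2^|K|` traces that make up `A₁`. -/

section LinearAlgebra

/-! ### Hadamard's inequality and row-by-row comparison of determinants. -/

open scoped ComplexOrder
open Determinantal (mix)

variable {𝕜 n : Type*} [RCLike 𝕜] [Fintype n]

/-- The squared Euclidean norm of a row of a matrix. -/
def Matrix.rowSq {m : Type*} (M : Matrix m n 𝕜) (i : m) : ℝ := ∑ j, ‖M i j‖ ^ 2

theorem Matrix.rowSq_nonneg {m : Type*} (M : Matrix m n 𝕜) (i : m) : 0 ≤ M.rowSq i :=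
  Finset.sum_nonneg fun _ _ => sq_nonneg _

variable [DecidableEq n]

/-- The eigenvalues of `M * Mᴴ` are nonnegative, with product `‖det M‖²` and sum at most the
dimension. AM–GM enters in the form `x ≤ exp (x - 1)`. -/
theorem Matrix.norm_det_sq_le_one (M : Matrix n n 𝕜) (h : ∀ i, M.rowSq i ≤ 1) :
    ‖M.det‖ ^ 2 ≤ 1 := by
  have hp : (M * M.conjTranspose).PosSemidef := Matrix.posSemidef_self_mul_conjTranspose M
  have hdet : ((‖M.det‖ ^ 2 : ℝ) : 𝕜) = ((∏ i, hp.isHermitian.eigenvalues i : ℝ) : 𝕜) := by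
    rw [RCLike.ofReal_prod, ← hp.isHermitian.det_eq_prod_eigenvalues, Matrix.det_mul,
      Matrix.det_conjTranspose, RCLike.star_def, RCLike.mul_conj, RCLike.ofReal_pow]
  have htr : ((∑ i, hp.isHermitian.eigenvalues i : ℝ) : 𝕜) = ((∑ i, M.rowSq i : ℝ) : 𝕜) := by
    rw [RCLike.ofReal_sum, ← hp.isHermitian.trace_eq_sum_eigenvalues, RCLike.ofReal_sum,
      Matrix.trace]
    refine Finset.sum_congr rfl fun i _ => ?_
    rw [Matrix.diag_apply, Matrix.mul_apply, Matrix.rowSq, RCLike.ofReal_sum]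
    refine Finset.sum_congr rfl fun j _ => ?_
    rw [Matrix.conjTranspose_apply, RCLike.star_def, RCLike.mul_conj, RCLike.ofReal_pow]
  rw [RCLike.ofReal_injective hdet]
  have htr := RCLike.ofReal_injective htr
  calc ∏ i, hp.isHermitian.eigenvalues i
      ≤ ∏ i, Real.exp (hp.isHermitian.eigenvalues i - 1) := by
        refine Finset.prod_le_prod (fun i _ => hp.eigenvalues_nonneg i) fun i _ => ?_
        have := Real.add_one_le_exp (hp.isHermitian.eigenvalues i - 1)
        linarith
    _ = Real.exp (∑ i, (hp.isHermitian.eigenvalues i - 1)) := (Real.exp_sum _ _).symm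
    _ ≤ 1 := by
        rw [Real.exp_le_one_iff, Finset.sum_sub_distrib, htr, ← Finset.sum_sub_distrib]
        exact Finset.sum_nonpos fun i _ => sub_nonpos.2 (h i)

/-- The **Hadamard inequality** for determinants. -/
theorem Matrix.norm_det_sq_le_prod_rowSq (M : Matrix n n 𝕜) :
    ‖M.det‖ ^ 2 ≤ ∏ i, M.rowSq i := by
  by_cases h0 : ∃ i, M.rowSq i = 0
  · obtain ⟨i, hi⟩ := h0
    have : M.det = 0 := Matrix.det_eq_zero_of_row_eq_zero i fun j => by
      have := (Finset.sum_eq_zero_iff_of_nonneg fun _ _ => sq_nonneg _).1 hi j (Finset.mem_univ j)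
      simpa using this
    rw [this]
    simpa using Finset.prod_nonneg fun i _ => M.rowSq_nonneg i
  push Not at h0
  have hpos : ∀ i, 0 < M.rowSq i := fun i => (M.rowSq_nonneg i).lt_of_ne' (h0 i)
  -- Rescaling to unit rows reduces to the previous lemma; zero rows have been set aside.
  let N : Matrix n n 𝕜 := Matrix.of fun i j => ((Real.sqrt (M.rowSq i))⁻¹ : ℝ) * M i j
  have hN : ∀ i, N.rowSq i ≤ 1 := fun i => by
    have : N.rowSq i = (Real.sqrt (M.rowSq i))⁻¹ ^ 2 * ∑ j, ‖M i j‖ ^ 2 := by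
      rw [Finset.mul_sum]
      refine Finset.sum_congr rfl fun j _ => ?_
      rw [show N i j = ((Real.sqrt (M.rowSq i))⁻¹ : ℝ) * M i j from rfl, norm_mul, mul_pow,
        RCLike.norm_ofReal, sq_abs]
    rw [this, inv_pow, Real.sq_sqrt (hpos i).le]
    exact (inv_mul_cancel₀ (h0 i)).le
  have hdet : M.det = (∏ i, ((Real.sqrt (M.rowSq i) : ℝ) : 𝕜)) * N.det := by
    rw [← Matrix.det_mul_column]
    congr 1
    ext i j
    have : Real.sqrt (M.rowSq i) ≠ 0 := (Real.sqrt_pos.2 (hpos i)).ne'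
    simp only [N, Matrix.of_apply]
    rw [← mul_assoc, ← RCLike.ofReal_mul, mul_inv_cancel₀ this, RCLike.ofReal_one, one_mul]
  have h1 := N.norm_det_sq_le_one hN
  rw [hdet, norm_mul, mul_pow, norm_prod, ← Finset.prod_pow]
  have : ∏ i, ‖((Real.sqrt (M.rowSq i) : ℝ) : 𝕜)‖ ^ 2 = ∏ i, M.rowSq i := by
    refine Finset.prod_congr rfl fun i _ => ?_
    rw [RCLike.norm_ofReal, sq_abs, Real.sq_sqrt (hpos i).le]
  rw [this]
  exact mul_le_of_le_one_right (Finset.prod_nonneg fun i _ => M.rowSq_nonneg i) h1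

/-- Every row `i` satisfies `‖Xᵢ‖² + ‖(1 - X)ᵢ‖² ≤ 1`. -/
def Matrix.RowContractive (X : Matrix n n 𝕜) : Prop := ∀ i, X.rowSq i + (1 - X).rowSq i ≤ 1

theorem Matrix.rowSq_mix (X : Matrix n n 𝕜) (C : Finset n) (i : n) :
    (mix X C).rowSq i = if i ∈ C then X.rowSq i else (1 - X).rowSq i := by
  by_cases h : i ∈ C <;> simp [Matrix.rowSq, mix, h]

/-- The determinant is affine in row `j`, so the difference is a determinant whose row `j` is `±(Y -
X) j`, with sign `-1` when `j ∉ C` because that row comes from `1 - X`. Hadamard's inequality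
finishes. -/
theorem norm_det_mix_updateRow_sub_sq_le (X Y : Matrix n n 𝕜) (j : n) (C : Finset n) :
    ‖(mix (X.updateRow j (Y j)) C).det - (mix X C).det‖ ^ 2 ≤
      (Y - X).rowSq j * ∏ i, if i = j then 1 else (mix X C).rowSq i := by
  let σ : 𝕜 := if j ∈ C then 1 else -1
  have e : mix (X.updateRow j (Y j)) C =
      (mix X C).updateRow j (mix X C j + σ • (Y - X) j) := by
    ext i l
    by_cases h : i = j
    · subst h
      by_cases hC : i ∈ C <;> simp [mix, hC, σ]
    · simp [mix, h]
  have e2 : (mix (X.updateRow j (Y j)) C).det - (mix X C).det =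
      ((mix X C).updateRow j (σ • (Y - X) j)).det := by
    rw [e, Matrix.det_updateRow_add, Matrix.updateRow_eq_self]
    ring
  rw [e2]
  refine (Matrix.norm_det_sq_le_prod_rowSq _).trans_eq ?_
  have hσ : ‖σ‖ = 1 := by
    simp only [σ]; split_ifs <;> simp
  have : ∀ i, ((mix X C).updateRow j (σ • (Y - X) j)).rowSq i =
      (if i = j then (Y - X).rowSq i else 1) * (if i = j then 1 else (mix X C).rowSq i) := by
    intro i
    by_cases h : i = j
    · subst h
      simp [Matrix.rowSq, norm_mul, hσ]
    · simp [Matrix.rowSq, h]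
  rw [Finset.prod_congr rfl fun i _ => this i, Finset.prod_mul_distrib]
  congr 1
  simp

theorem norm_det_mix_updateRow_sub_sq_le_rowSq {X : Matrix n n 𝕜} (hX : X.RowContractive)
    (Y : Matrix n n 𝕜) (j : n) (C : Finset n) :
    ‖(mix (X.updateRow j (Y j)) C).det - (mix X C).det‖ ^ 2 ≤ (Y - X).rowSq j := by
  refine (norm_det_mix_updateRow_sub_sq_le X Y j C).trans ?_
  refine mul_le_of_le_one_right (Matrix.rowSq_nonneg _ _) (Finset.prod_le_one ?_ ?_)
  · intro i _; split_ifs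
    · exact zero_le_one
    · exact Matrix.rowSq_nonneg _ _
  · intro i _; split_ifs
    · exact le_rfl
    · have := hX i
      have h1 := X.rowSq_nonneg i
      have h2 := (1 - X).rowSq_nonneg i
      rw [Matrix.rowSq_mix]; split_ifs <;> linarith

/-- Summed over `C`, the Hadamard products factor as a product over `i` of two-term sums. For `i ≠
j` such a sum is at most `1` by row contractivity; for `i = j` it is `1 + 1`. This replaces the
naive factor `2^|n|` by `2`. -/
theorem sum_norm_det_mix_updateRow_sub_sq_le {X : Matrix n n 𝕜} (hX : X.RowContractive)
    (Y : Matrix n n 𝕜) (j : n) :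
    ∑ C : Finset n, ‖(mix (X.updateRow j (Y j)) C).det - (mix X C).det‖ ^ 2 ≤
      2 * (Y - X).rowSq j := by
  refine (Finset.sum_le_sum fun C _ => norm_det_mix_updateRow_sub_sq_le X Y j C).trans ?_
  rw [← Finset.mul_sum, mul_comm]
  refine mul_le_mul_of_nonneg_right ?_ (Matrix.rowSq_nonneg _ _)
  have h : ∀ C : Finset n, (∏ i, if i = j then 1 else (mix X C).rowSq i) =
      (∏ i ∈ C, if i = j then 1 else X.rowSq i) *
        ∏ i ∈ Finset.univ \ C, if i = j then 1 else (1 - X).rowSq i := by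
    intro C
    rw [← Finset.prod_sdiff (Finset.subset_univ C), mul_comm]
    congr 1
    · refine Finset.prod_congr rfl fun i hi => ?_
      simp [Matrix.rowSq_mix, hi]
    · refine Finset.prod_congr rfl fun i hi => ?_
      simp [Matrix.rowSq_mix, (Finset.mem_sdiff.1 hi).2]
  rw [Finset.sum_congr rfl fun C _ => h C, ← Finset.powerset_univ, ← Finset.prod_add,
    ← Finset.mul_prod_erase _ _ (Finset.mem_univ j)]
  simp only [if_true]
  have : ∏ i ∈ Finset.univ.erase j, ((if i = j then 1 else X.rowSq i) +
      if i = j then 1 else (1 - X).rowSq i) ≤ 1 := by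
    refine Finset.prod_le_one ?_ ?_
    · intro i hi
      have := Finset.ne_of_mem_erase hi
      simpa [this] using add_nonneg (X.rowSq_nonneg i) ((1 - X).rowSq_nonneg i)
    · intro i hi
      have := Finset.ne_of_mem_erase hi
      simpa [this] using hX i
  linarith

/-- Rows of `X` are replaced by rows of `Y` one at a time. Every intermediate matrix is row
contractive, since the condition is imposed row by row. The target `V` is general so that `Φ` may be
a single determinant or the vector of all of them. -/
theorem Matrix.RowContractive.norm_sub_le {V : Type*} [SeminormedAddCommGroup V]
    (Φ : Matrix n n 𝕜 → V) (w : ℝ)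
    (hΦ : ∀ X : Matrix n n 𝕜, X.RowContractive → ∀ (Y : Matrix n n 𝕜) (j : n),
      ‖Φ (X.updateRow j (Y j)) - Φ X‖ ^ 2 ≤ w * (Y - X).rowSq j)
    {X Y : Matrix n n 𝕜} (hX : X.RowContractive) (hY : Y.RowContractive) :
    ‖Φ Y - Φ X‖ ^ 2 ≤ w * (Fintype.card n * ∑ j, (Y - X).rowSq j) := by
  let Z : Finset n → Matrix n n 𝕜 := fun s => Matrix.of fun i j => if i ∈ s then Y i j else X i j
  have hZ : ∀ s, (Z s).RowContractive := by
    intro s i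
    by_cases h : i ∈ s
    · simpa [Matrix.rowSq, Z, h] using hY i
    · simpa [Matrix.rowSq, Z, h] using hX i
  have key : ∀ s : Finset n, ‖Φ (Z s) - Φ X‖ ≤ ∑ j ∈ s, Real.sqrt (w * (Y - X).rowSq j) := by
    intro s
    induction s using Finset.induction_on with
    | empty =>
      have : Z ∅ = X := by ext; simp [Z]
      simp [this]
    | insert a s ha ih =>
      have e : Z (insert a s) = (Z s).updateRow a (Y a) := by
        ext i j
        by_cases h : i = a
        · subst h; simp [Z]
        · simp [Z, h]
      have h1 : ((Y - Z s) : Matrix n n 𝕜).rowSq a = (Y - X).rowSq a := by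
        simp [Matrix.rowSq, Z, ha]
      have h2 := Real.le_sqrt_of_sq_le (hΦ (Z s) (hZ s) Y a)
      rw [h1, ← e] at h2
      rw [Finset.sum_insert ha]
      calc _ ≤ ‖Φ (Z (insert a s)) - Φ (Z s)‖ + ‖Φ (Z s) - Φ X‖ :=
            norm_sub_le_norm_sub_add_norm_sub _ _ _
        _ ≤ _ := add_le_add h2 ih
  have hu : Z Finset.univ = Y := by ext; simp [Z]
  have h1 := key Finset.univ
  rw [hu] at h1
  -- The sign of `w` is not assumed; the bound in `hΦ` itself forces these products to be
  -- nonnegative.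
  have hnn : ∀ j, 0 ≤ w * (Y - X).rowSq j := fun j => by
    have h2 := hΦ X hX Y j
    exact (sq_nonneg _).trans h2
  calc ‖Φ Y - Φ X‖ ^ 2 ≤ (∑ j, Real.sqrt (w * (Y - X).rowSq j)) ^ 2 :=
        pow_le_pow_left₀ (norm_nonneg _) h1 2
    _ ≤ (Finset.univ : Finset n).card * ∑ j, Real.sqrt (w * (Y - X).rowSq j) ^ 2 :=
        sq_sum_le_card_mul_sum_sq
    _ = w * (Fintype.card n * ∑ j, (Y - X).rowSq j) := by
        rw [Finset.sum_congr rfl fun j _ => Real.sq_sqrt (hnn j), ← Finset.mul_sum,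
          Finset.card_univ]
        ring

/-- The squared variation of the elementary probabilities of a determinantal measure, summed over
any family of elementary events, is controlled by the variation of the rows of its kernel. -/
theorem Matrix.RowContractive.sum_norm_det_mix_sub_sq_le {X Y : Matrix n n 𝕜}
    (hX : X.RowContractive) (hY : Y.RowContractive) (𝒞 : Finset (Finset n)) :
    ∑ C ∈ 𝒞, ‖(mix Y C).det - (mix X C).det‖ ^ 2 ≤
      min (𝒞.card : ℝ) 2 * (Fintype.card n * ∑ j, (Y - X).rowSq j) := by
  have h1 : ∀ C ∈ 𝒞, ‖(mix Y C).det - (mix X C).det‖ ^ 2 ≤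
      Fintype.card n * ∑ j, (Y - X).rowSq j := by
    intro C _
    have := Matrix.RowContractive.norm_sub_le (fun Z : Matrix n n 𝕜 => (mix Z C).det) 1
      (fun X hX Y j => by
        rw [one_mul]; exact norm_det_mix_updateRow_sub_sq_le_rowSq hX Y j C) hX hY
    rwa [one_mul] at this
  have h2 : ∑ C : Finset n, ‖(mix Y C).det - (mix X C).det‖ ^ 2 ≤
      2 * (Fintype.card n * ∑ j, (Y - X).rowSq j) := by
    have := Matrix.RowContractive.norm_sub_le
      (fun Z : Matrix n n 𝕜 => WithLp.toLp 2 fun C : Finset n => (mix Z C).det) 2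
      (fun X hX Y j => by
        rw [← WithLp.toLp_sub, EuclideanSpace.norm_sq_eq]
        exact sum_norm_det_mix_updateRow_sub_sq_le hX Y j) hX hY
    rwa [← WithLp.toLp_sub, EuclideanSpace.norm_sq_eq] at this
  have h0 : 0 ≤ Fintype.card n * ∑ j, (Y - X).rowSq j :=
    mul_nonneg (Nat.cast_nonneg _) (Finset.sum_nonneg fun _ _ => Matrix.rowSq_nonneg _ _)
  rw [min_mul_of_nonneg _ _ h0]
  refine le_min ?_ ?_
  · simpa using Finset.sum_le_sum h1
  · exact (Finset.sum_le_sum_of_subset_of_nonneg (Finset.subset_univ 𝒞)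
      fun _ _ _ => sq_nonneg _).trans h2

/-- A Hermitian matrix `R` with `R² ≤ R` is row contractive. -/
theorem Matrix.RowContractive.of_rowSq_le {R : Matrix n n 𝕜}
    (h : ∀ i, R.rowSq i ≤ RCLike.re (R i i)) : R.RowContractive := by
  intro i
  have e : (1 - R).rowSq i = 1 - 2 * RCLike.re (R i i) + R.rowSq i := by
    have : ∀ j, ‖(1 - R) i j‖ ^ 2 =
        (if i = j then 1 - 2 * RCLike.re (R i j) else 0) + ‖R i j‖ ^ 2 := by
      intro j
      by_cases hij : i = j
      · subst hij
        simp only [Matrix.sub_apply, Matrix.one_apply_eq, if_true]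
        rw [@norm_sub_sq 𝕜]
        simp
      · simp [hij]
    simp only [Matrix.rowSq, this, Finset.sum_add_distrib]
    simp
  rw [e]
  linarith [h i]

end LinearAlgebra

/-! ### The kernel of a determinantal measure conditioned on a finite configuration. -/

section ConditionalKernel

open scoped ComplexOrder Matrix
open Determinantal (mix)

variable {𝕜 f r : Type*} [RCLike 𝕜] [Fintype f] [DecidableEq f]

/-- The block `A` of a kernel, shifted by the indicator of the complement of `T`. -/
def Determinantal.shift (A : Matrix f f 𝕜) (T : Finset f) : Matrix f f 𝕜 :=
  A - Matrix.diagonal fun i => if i ∈ T then 0 else 1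

/-- The kernel on `r` of a determinantal measure with block kernel `(A, B; Bᴴ, D)` conditioned on
its restriction to `f` being `T`. -/
noncomputable def Determinantal.condKernel (A : Matrix f f 𝕜) (B : Matrix f r 𝕜)
    (D : Matrix r r 𝕜) (T : Finset f) : Matrix r r 𝕜 :=
  D - Bᴴ * (Determinantal.shift A T)⁻¹ * B

open Determinantal (shift condKernel)

/-- The diagonal matrix of signs: `1` on `T` and `-1` off `T`. -/
def Determinantal.signs (𝕜 : Type*) [RCLike 𝕜] (T : Finset f) : Matrix f f 𝕜 :=
  Matrix.diagonal fun i => if i ∈ T then 1 else -1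

open Determinantal (signs)

theorem Determinantal.isHermitian_condKernel {A : Matrix f f 𝕜} (hA : A.IsHermitian)
    (B : Matrix f r 𝕜) {D : Matrix r r 𝕜} (hD : D.IsHermitian) (T : Finset f) :
    (condKernel A B D T).IsHermitian := by
  have : (shift A T).IsHermitian := by
    refine hA.sub (Matrix.isHermitian_diagonal_of_self_adjoint _ ?_)
    ext i; simp [apply_ite]
  refine hD.sub ?_
  have := Matrix.isHermitian_conjTranspose_mul_mul B this.inv
  exact this

/-- Off `T` a row of `1 - A` is minus a row of `A - 1`. Pulling the signs out leaves a shift of `A`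
by a diagonal matrix, which is compatible with Schur complements. -/
theorem Determinantal.mix_eq_signs_mul_shift (A : Matrix f f 𝕜) (T : Finset f) :
    mix A T = signs 𝕜 T * shift A T := by
  ext i j
  by_cases hij : i = j
  · subst hij
    by_cases h : i ∈ T <;> simp [mix, signs, shift, h]
  · by_cases h : i ∈ T <;> simp [mix, signs, shift, h, hij]

theorem Determinantal.isUnit_det_signs (T : Finset f) : IsUnit (signs 𝕜 T).det := by
  rw [signs, Matrix.det_diagonal]
  refine IsUnit.mk0 _ (Finset.prod_ne_zero_iff.2 fun i _ => ?_)
  split_ifs <;> simp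

theorem Determinantal.sum_det_mix (A : Matrix f f 𝕜) : ∑ T : Finset f, (mix A T).det = 1 := by
  simpa using Determinantal.sum_det_piecewise A ∅

/-- Entry `(i, j)` of the adjugate replaces row `j`, so it does not see whether `j ∈ T`, while
toggling `j` in `T` flips the sign. The terms cancel in pairs. -/
theorem Determinantal.sum_det_signs_smul_adjugate (A : Matrix f f 𝕜) :
    ∑ T : Finset f, (signs 𝕜 T).det • (shift A T).adjugate = 0 := by
  ext i j
  rw [Matrix.sum_apply]
  simp only [Matrix.smul_apply, Matrix.adjugate_apply, smul_eq_mul, Matrix.zero_apply]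
  refine Finset.sum_ninvolution (fun T => symmDiff T {j}) ?_ ?_ (fun _ => Finset.mem_univ _) ?_
  · intro T
    have h1 : (shift A (symmDiff T {j})).updateRow j (Pi.single i 1) =
        (shift A T).updateRow j (Pi.single i 1) := by
      ext a b
      by_cases h : a = j
      · subst h; simp
      · have : a ∈ symmDiff T {j} ↔ a ∈ T := by simp [Finset.mem_symmDiff, h]
        simp [h, shift, Matrix.diagonal_apply, this]
    have h2 : (signs 𝕜 (symmDiff T {j})).det = -(signs 𝕜 T).det := by
      simp only [signs, Matrix.det_diagonal]
      rw [← Finset.mul_prod_erase _ _ (Finset.mem_univ j),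
        ← Finset.mul_prod_erase (Finset.univ) (fun i => if i ∈ T then (1 : 𝕜) else -1)
          (Finset.mem_univ j), ← neg_mul]
      congr 1
      · by_cases h : j ∈ T <;> simp [Finset.mem_symmDiff, h]
      · refine Finset.prod_congr rfl fun a ha => ?_
        have := Finset.ne_of_mem_erase ha
        simp [Finset.mem_symmDiff, this]
    rw [h1, h2]
    ring
  · intro T _ h
    have : j ∈ symmDiff T {j} ↔ j ∈ T := by rw [h]
    simp [Finset.mem_symmDiff] at this
  · intro T
    simp

/-- The conditional kernels average to the unconditional one. The weight `det (mix A T)` turns the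
inverse of the shift into a signed adjugate, and these sum to zero. -/
theorem Determinantal.sum_det_mix_smul_condKernel {A : Matrix f f 𝕜} (B : Matrix f r 𝕜)
    (D : Matrix r r 𝕜) (hA : ∀ T, IsUnit (shift A T).det) :
    ∑ T : Finset f, (mix A T).det • condKernel A B D T = D := by
  have h : ∀ T : Finset f, (mix A T).det • condKernel A B D T =
      (mix A T).det • D - Bᴴ * ((signs 𝕜 T).det • (shift A T).adjugate) * B := by
    intro T
    have : (signs 𝕜 T).det • (shift A T).adjugate = (mix A T).det • (shift A T)⁻¹ := by
      rw [mix_eq_signs_mul_shift, Matrix.det_mul, mul_smul]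
      congr 1
      rw [Matrix.inv_def, smul_smul, Ring.mul_inverse_cancel _ (hA T), one_smul]
    rw [this, condKernel, smul_sub, Matrix.mul_smul, Matrix.smul_mul]
  rw [Finset.sum_congr rfl fun T _ => h T, Finset.sum_sub_distrib, ← Finset.sum_smul,
    sum_det_mix, one_smul, ← Matrix.sum_mul, ← Matrix.mul_sum, sum_det_signs_smul_adjugate]
  simp

variable [Fintype r] [DecidableEq r]

/-- This is the chain rule for probabilities: the Schur complement of the `f` block is, up to signs,
the shifted conditional kernel. -/
theorem Determinantal.det_mix_fromBlocks {A : Matrix f f 𝕜} (B : Matrix f r 𝕜) (D : Matrix r r 𝕜)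
    {T : Finset f} (hA : IsUnit (shift A T).det) (C : Finset r) :
    (mix (Matrix.fromBlocks A B Bᴴ D) (T.disjSum C)).det =
      (mix A T).det * (mix (condKernel A B D T) C).det := by
  have e : mix (Matrix.fromBlocks A B Bᴴ D) (T.disjSum C) =
      Matrix.fromBlocks (mix A T) (signs 𝕜 T * B) (signs 𝕜 C * Bᴴ) (mix D C) := by
    ext i j
    rcases i with i | i <;> rcases j with j | j
    · by_cases h : i ∈ T <;> simp [mix, h, Matrix.one_apply]
    · by_cases h : i ∈ T <;> simp [mix, h, signs]
    · by_cases h : i ∈ C <;> simp [mix, h, signs]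
    · by_cases h : i ∈ C <;> simp [mix, h, Matrix.one_apply]
  have hu : IsUnit (mix A T).det := by
    rw [mix_eq_signs_mul_shift, Matrix.det_mul]
    exact (isUnit_det_signs T).mul hA
  let _ : Invertible (mix A T) := Matrix.invertibleOfIsUnitDet _ hu
  rw [e, Matrix.det_fromBlocks₁₁, Matrix.invOf_eq_nonsing_inv]
  congr 2
  have h1 : (mix A T)⁻¹ * (signs 𝕜 T * B) = (shift A T)⁻¹ * B := by
    rw [mix_eq_signs_mul_shift, Matrix.mul_inv_rev, Matrix.mul_assoc,
      ← Matrix.mul_assoc _ _ B, Matrix.nonsing_inv_mul _ (isUnit_det_signs T), Matrix.one_mul]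
  have h2 : shift (condKernel A B D T) C = shift D C - Bᴴ * (shift A T)⁻¹ * B :=
    sub_right_comm _ _ _
  rw [Matrix.mul_assoc, h1, mix_eq_signs_mul_shift D, mix_eq_signs_mul_shift (condKernel _ _ _ _),
    h2, Matrix.mul_sub]
  simp only [Matrix.mul_assoc]

/-- Strictly contractive positive kernels have invertible shifts. -/
theorem Determinantal.isUnit_det_shift {A : Matrix f f 𝕜} (hA : A.PosDef) (hA' : (1 - A).PosDef)
    (T : Finset f) : IsUnit (shift A T).det := by
  have hH : Aᴴ = A := hA.isHermitian
  have hpos : (A * (1 - A) * A + (1 - A) * A * (1 - A)).PosDef := by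
    refine Matrix.PosDef.add_posSemidef ?_ ?_
    · have := hA'.conjTranspose_mul_mul_same (B := A)
        (Matrix.mulVec_injective_of_isUnit hA.isUnit)
      rwa [hH] at this
    · have := hA.posSemidef.mul_mul_conjTranspose_same (1 - A)
      rwa [Matrix.conjTranspose_sub, hH, Matrix.conjTranspose_one] at this
  have e : A * (1 - A) * A + (1 - A) * A * (1 - A) = A - A * A := by noncomm_ring
  rw [e] at hpos
  -- Write `π` for the diagonal projection off `T`. A null vector `v` of the shift has `A v = π v`,
  -- so `⟨v, A v⟩ = ‖π v‖² = ‖A v‖²`, which contradicts `A - A² > 0`.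
  by_contra hu
  obtain ⟨v, hv, hv0⟩ := Matrix.exists_mulVec_eq_zero_iff.2 (by simpa [isUnit_iff_ne_zero] using hu)
  have h1 : A *ᵥ v = (Matrix.diagonal fun i => if i ∈ T then (0 : 𝕜) else 1) *ᵥ v := by
    have hv1 : (A - Matrix.diagonal fun i => if i ∈ T then (0 : 𝕜) else 1) *ᵥ v = 0 := hv0
    rwa [Matrix.sub_mulVec, sub_eq_zero] at hv1
  have h2 := hpos.dotProduct_mulVec_pos hv
  have h3 : star v ⬝ᵥ ((A * A) *ᵥ v) = star (A *ᵥ v) ⬝ᵥ (A *ᵥ v) := by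
    rw [Matrix.star_mulVec, hH, ← Matrix.dotProduct_mulVec, Matrix.mulVec_mulVec]
  rw [Matrix.sub_mulVec, dotProduct_sub, h3, h1] at h2
  refine h2.ne' (sub_eq_zero.2 ?_)
  simp only [dotProduct, Matrix.mulVec_diagonal]
  refine Finset.sum_congr rfl fun i _ => ?_
  by_cases h : i ∈ T <;> simp [h, Matrix.mulVec_diagonal]

theorem Matrix.rowSq_eq_re_dotProduct (M : Matrix r r 𝕜) (hM : M.IsHermitian) (x : r) :
    M.rowSq x = RCLike.re (star (M *ᵥ Pi.single x 1) ⬝ᵥ (M *ᵥ Pi.single x 1)) := by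
  simp only [Matrix.rowSq, dotProduct, map_sum, Pi.star_apply, Matrix.mulVec_single_one]
  refine Finset.sum_congr rfl fun j _ => ?_
  rw [Matrix.col_apply, RCLike.star_def, RCLike.conj_mul, ← hM.apply x j, norm_star]
  norm_cast

/-- A positive contraction `M` satisfies `M² ≤ M`. -/
theorem Matrix.PosSemidef.re_dotProduct_mulVec_le {M : Matrix r r 𝕜} (hM : M.PosSemidef)
    (hM' : (1 - M).PosSemidef) (w : r → 𝕜) :
    RCLike.re (star (M *ᵥ w) ⬝ᵥ (M *ᵥ w)) ≤ RCLike.re (star w ⬝ᵥ (M *ᵥ w)) := by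
  have hH : Mᴴ = M := hM.isHermitian
  have hpos : (M * (1 - M) * M + (1 - M) * M * (1 - M)).PosSemidef := by
    refine Matrix.PosSemidef.add ?_ ?_
    · simpa [hH] using hM'.mul_mul_conjTranspose_same M
    · have := hM.mul_mul_conjTranspose_same (1 - M)
      rwa [Matrix.conjTranspose_sub, hH, Matrix.conjTranspose_one] at this
  have e : M * (1 - M) * M + (1 - M) * M * (1 - M) = M - M * M := by noncomm_ring
  rw [e] at hpos
  have h2 := hpos.dotProduct_mulVec_nonneg w
  have h3 : star w ⬝ᵥ ((M * M) *ᵥ w) = star (M *ᵥ w) ⬝ᵥ (M *ᵥ w) := by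
    rw [Matrix.star_mulVec, hH, ← Matrix.dotProduct_mulVec, Matrix.mulVec_mulVec]
  rw [Matrix.sub_mulVec, dotProduct_sub, h3] at h2
  have := (RCLike.nonneg_iff.1 h2).1
  rw [map_sub] at this
  linarith

theorem Matrix.PosSemidef.rowSq_le {M : Matrix r r 𝕜} (hM : M.PosSemidef)
    (hM' : (1 - M).PosSemidef) (x : r) : M.rowSq x ≤ RCLike.re (M x x) := by
  rw [M.rowSq_eq_re_dotProduct hM.isHermitian]
  refine (hM.re_dotProduct_mulVec_le hM' _).trans_eq ?_
  have : star (Pi.single x 1 : r → 𝕜) = Pi.single x 1 := by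
    ext i; by_cases h : i = x
    · subst h; simp
    · simp [h]
  rw [this, single_one_dotProduct, Matrix.mulVec_single_one, Matrix.col_apply]

/-- Extend a basis vector `v` on `r` by the `u` for which `Q (u, v) = (π u, R v)`, with `π` the
diagonal projection off `T`. In `‖Q w‖² ≤ ⟨w, Q w⟩` for `w = (u, v)`, the terms `‖π u‖²` and `⟨u, π
u⟩` are equal and cancel, leaving `‖R v‖² ≤ ⟨v, R v⟩`. -/
theorem Determinantal.rowSq_condKernel_le {A : Matrix f f 𝕜} {B : Matrix f r 𝕜}
    {D : Matrix r r 𝕜} (hQ : (Matrix.fromBlocks A B Bᴴ D).PosSemidef)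
    (hQ' : (1 - Matrix.fromBlocks A B Bᴴ D).PosSemidef) {T : Finset f}
    (hu : IsUnit (shift A T).det) (x : r) :
    (condKernel A B D T).rowSq x ≤ RCLike.re (condKernel A B D T x x) := by
  obtain ⟨hA, -, -, hD⟩ := Matrix.isHermitian_fromBlocks_iff.1 hQ.isHermitian
  set R := condKernel A B D T with hR
  rw [R.rowSq_eq_re_dotProduct (isHermitian_condKernel hA B hD T)]
  set v : r → 𝕜 := Pi.single x 1 with hv
  let u : f → 𝕜 := -((shift A T)⁻¹ *ᵥ (B *ᵥ v))
  let pu : f → 𝕜 := (Matrix.diagonal fun i => if i ∈ T then (0 : 𝕜) else 1) *ᵥ u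
  have h1 : A *ᵥ u + B *ᵥ v = pu := by
    have : shift A T *ᵥ u = -(B *ᵥ v) := by
      rw [Matrix.mulVec_neg, Matrix.mulVec_mulVec, Matrix.mul_nonsing_inv _ hu, Matrix.one_mulVec]
    rw [shift, Matrix.sub_mulVec] at this
    rw [sub_eq_iff_eq_add] at this
    rw [this]
    simp [pu]
  have h2 : Bᴴ *ᵥ u + D *ᵥ v = R *ᵥ v := by
    rw [hR, condKernel, Matrix.sub_mulVec, Matrix.mulVec_neg, ← Matrix.mulVec_mulVec,
      ← Matrix.mulVec_mulVec]
    abel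
  have h3 : Matrix.fromBlocks A B Bᴴ D *ᵥ Sum.elim u v = Sum.elim pu (R *ᵥ v) := by
    rw [Matrix.fromBlocks_mulVec]
    simp [← h1, ← h2]
  have h4 := hQ.re_dotProduct_mulVec_le hQ' (Sum.elim u v)
  have hs : ∀ (a : f → 𝕜) (b : r → 𝕜), star (Sum.elim a b) = Sum.elim (star a) (star b) := by
    intro a b; ext i; rcases i with i | i <;> rfl
  rw [h3, hs, hs, sumElim_dotProduct_sumElim, sumElim_dotProduct_sumElim, map_add, map_add] at h4
  have h5 : star u ⬝ᵥ pu = star pu ⬝ᵥ pu := by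
    simp only [dotProduct, pu, Matrix.mulVec_diagonal]
    refine Finset.sum_congr rfl fun i _ => ?_
    by_cases h : i ∈ T <;> simp [h, Matrix.mulVec_diagonal]
  rw [h5, add_le_add_iff_left] at h4
  refine h4.trans_eq ?_
  have : star v = v := by
    ext i; by_cases h : i = x
    · subst h; simp [hv]
    · simp [hv, h]
  rw [this, hv, single_one_dotProduct, Matrix.mulVec_single_one, Matrix.col_apply]

end ConditionalKernel

/-! ### Mean squared fluctuation of conditional probabilities on finite sets. -/

section ConditionalVariation

open scoped ComplexOrder Matrix
open Determinantal (mix shift condKernel)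

variable {𝕜 f r k : Type*} [RCLike 𝕜] [Fintype f] [Fintype r] [Fintype k]

theorem sum_mul_norm_sub_sq {ι V : Type*} [NormedAddCommGroup V] [InnerProductSpace 𝕜 V]
    (s : Finset ι) (p : ι → ℝ) (a : ι → V) (b : V) (hp : ∑ i ∈ s, p i = 1)
    (hb : ∑ i ∈ s, (p i : 𝕜) • a i = b) :
    ∑ i ∈ s, p i * ‖a i - b‖ ^ 2 = ∑ i ∈ s, p i * ‖a i‖ ^ 2 - ‖b‖ ^ 2 := by
  have h1 : ∑ i ∈ s, p i * RCLike.re (inner 𝕜 b (a i)) = ‖b‖ ^ 2 := by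
    rw [← inner_self_eq_norm_sq (𝕜 := 𝕜) b]
    nth_rewrite 3 [← hb]
    rw [inner_sum, map_sum]
    refine Finset.sum_congr rfl fun i _ => ?_
    rw [inner_smul_right, RCLike.re_ofReal_mul]
  have h2 : ∀ i, p i * ‖a i - b‖ ^ 2 =
      p i * ‖a i‖ ^ 2 - 2 * (p i * RCLike.re (inner 𝕜 b (a i))) + p i * ‖b‖ ^ 2 := by
    intro i
    rw [norm_sub_rev, norm_sub_sq (𝕜 := 𝕜)]
    ring
  rw [Finset.sum_congr rfl fun i _ => h2 i, Finset.sum_add_distrib, Finset.sum_sub_distrib,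
    ← Finset.mul_sum, h1, ← Finset.sum_mul, hp]
  ring

theorem Matrix.rowSq_submatrix_le {m : Type*} (M : Matrix m r 𝕜) {l : Type*} (g : l → m)
    (κ : k ↪ r) (x : l) : (M.submatrix g κ).rowSq x ≤ M.rowSq (g x) := by
  have : (M.submatrix g κ).rowSq x = ∑ j ∈ Finset.univ.map κ, ‖M (g x) j‖ ^ 2 := by
    rw [Finset.sum_map]; rfl
  rw [this]
  exact Finset.sum_le_sum_of_subset_of_nonneg (Finset.subset_univ _) fun _ _ _ => sq_nonneg _

variable [DecidableEq f] [DecidableEq r] [DecidableEq k]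

theorem Determinantal.ofReal_re_det_mix {Q : Matrix f f 𝕜} (hQ : Q.PosSemidef)
    (hQ' : (1 - Q).PosSemidef) (T : Finset f) :
    ((RCLike.re (mix Q T).det : ℝ) : 𝕜) = (mix Q T).det :=
  RCLike.conj_eq_iff_re.1 (RCLike.conj_eq_iff_im.2
    (RCLike.nonneg_iff.1 (Determinantal.det_piecewise_nonneg hQ hQ' T)).2)

/-- As `D` is the mean of the conditional kernels, the left side is the mean of their `rowSq` minus
that of `D`. Each `rowSq` is at most a diagonal entry, which is linear in the kernel and so averages
to `D x x`. -/
theorem Determinantal.sum_re_det_mix_mul_rowSq_condKernel_sub_le {A : Matrix f f 𝕜}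
    {B : Matrix f r 𝕜} {D : Matrix r r 𝕜} (hQ : (Matrix.fromBlocks A B Bᴴ D).PosSemidef)
    (hQ' : (1 - Matrix.fromBlocks A B Bᴴ D).PosSemidef) (hA : A.PosSemidef)
    (hA' : (1 - A).PosSemidef) (hu : ∀ T, IsUnit (shift A T).det) (x : r) :
    ∑ T, RCLike.re (mix A T).det * (condKernel A B D T - D).rowSq x ≤
      RCLike.re (D x x) - D.rowSq x := by
  have hp : ∑ T, RCLike.re (mix A T).det = 1 := by
    rw [← map_sum, Determinantal.sum_det_mix, RCLike.one_re]
  have hD : ∑ T, ((RCLike.re (mix A T).det : ℝ) : 𝕜) • condKernel A B D T = D := by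
    simp only [ofReal_re_det_mix hA hA']
    exact Determinantal.sum_det_mix_smul_condKernel B D hu
  have hb : ∀ y, ∑ T, ((RCLike.re (mix A T).det : ℝ) : 𝕜) • condKernel A B D T x y = D x y := by
    intro y
    have := congrFun (congrFun hD x) y
    rwa [Matrix.sum_apply] at this
  have h1 : ∑ T, RCLike.re (mix A T).det * (condKernel A B D T - D).rowSq x =
      ∑ T, RCLike.re (mix A T).det * (condKernel A B D T).rowSq x - D.rowSq x := by
    simp only [Matrix.rowSq, Matrix.sub_apply, Finset.mul_sum]
    rw [Finset.sum_comm, Finset.sum_comm (s := Finset.univ (α := Finset f)),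
      ← Finset.sum_sub_distrib]
    exact Finset.sum_congr rfl fun y _ =>
      sum_mul_norm_sub_sq (𝕜 := 𝕜) _ _ (fun T => condKernel A B D T x y) _ hp (hb y)
  rw [h1]
  refine sub_le_sub_right ?_ _
  have h2 : ∑ T, RCLike.re (mix A T).det * RCLike.re (condKernel A B D T x x) =
      RCLike.re (D x x) := by
    rw [← hb x, map_sum]
    refine Finset.sum_congr rfl fun T _ => ?_
    rw [smul_eq_mul, RCLike.re_ofReal_mul]
  rw [← h2]
  refine Finset.sum_le_sum fun T _ => mul_le_mul_of_nonneg_left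
    (Determinantal.rowSq_condKernel_le hQ hQ' (hu T) x) ?_
  exact (RCLike.nonneg_iff.1 (Determinantal.det_piecewise_nonneg hA hA' T)).1

/-- The mean squared deviation of the conditional elementary probabilities on `k`, given the
configuration on `f`, for a determinantal measure with kernel `Q` on `f ⊕ r`, where `k ⊆ r`. -/
noncomputable def Determinantal.deviation (Q : Matrix (f ⊕ r) (f ⊕ r) 𝕜) (κ : k ↪ r)
    (C : Finset k) (T : Finset f) : ℝ :=
  RCLike.re (mix (Q.submatrix Sum.inl Sum.inl) T).det *
    ‖(mix (Q.submatrix (Sum.map id κ) (Sum.map id κ)) (T.disjSum C)).det /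
      (mix (Q.submatrix Sum.inl Sum.inl) T).det -
      (mix (Q.submatrix (Sum.inr ∘ κ) (Sum.inr ∘ κ)) C).det‖ ^ 2

theorem Matrix.PosSemidef.one_sub_submatrix {m l : Type*} [DecidableEq m] [DecidableEq l]
    {Q : Matrix m m 𝕜} (hQ : (1 - Q).PosSemidef) {g : l → m} (hg : Function.Injective g) :
    (1 - Q.submatrix g g).PosSemidef := by
  have := hQ.submatrix g
  rwa [Matrix.submatrix_sub, Pi.sub_apply, Pi.sub_apply, Matrix.submatrix_one _ hg] at this

/-- Determinants are compared on `k` only, but rows are measured on all of `r`: enlarging `r`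
decreases the right side, and this is what makes it sharp in the limit. -/
theorem Determinantal.sum_deviation_le_of_posDef {Q : Matrix (f ⊕ r) (f ⊕ r) 𝕜} (hQ : Q.PosDef)
    (hQ' : (1 - Q).PosDef) (κ : k ↪ r) (𝒞 : Finset (Finset k)) :
    ∑ C ∈ 𝒞, ∑ T, deviation Q κ C T ≤
      min (𝒞.card : ℝ) 2 * (Fintype.card k * ∑ x : k,
        (RCLike.re (Q (Sum.inr (κ x)) (Sum.inr (κ x))) -
          (Q.submatrix Sum.inr Sum.inr).rowSq (κ x))) := by
  obtain ⟨A, B, B', D, rfl⟩ : ∃ A B B' D, Q = Matrix.fromBlocks A B B' D :=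
    ⟨_, _, _, _, (Matrix.fromBlocks_toBlocks Q).symm⟩
  obtain ⟨-, rfl, -, -⟩ := Matrix.isHermitian_fromBlocks_iff.1 hQ.isHermitian
  have hA : A.PosDef := hQ.submatrix Sum.inl_injective
  have hA' : (1 - A).PosDef := by
    have := hQ'.submatrix (e := Sum.inl) Sum.inl_injective
    rwa [Matrix.submatrix_sub, Pi.sub_apply, Pi.sub_apply,
      Matrix.submatrix_one _ Sum.inl_injective] at this
  have hD : D.PosSemidef := hQ.posSemidef.submatrix Sum.inr
  have hD' : (1 - D).PosSemidef := hQ'.posSemidef.one_sub_submatrix (g := Sum.inr) Sum.inr_injective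
  have hu := Determinantal.isUnit_det_shift hA hA'
  have hDκ : (D.submatrix κ κ).RowContractive := Matrix.RowContractive.of_rowSq_le fun x =>
    (Matrix.rowSq_submatrix_le D κ κ x).trans (hD.rowSq_le hD' (κ x))
  have hRκ : ∀ T, ((condKernel A B D T).submatrix κ κ).RowContractive := fun T =>
    Matrix.RowContractive.of_rowSq_le fun x => (Matrix.rowSq_submatrix_le _ κ κ x).trans
      (Determinantal.rowSq_condKernel_le hQ.posSemidef hQ'.posSemidef (hu T) (κ x))
  have hdev : ∀ C T, deviation (Matrix.fromBlocks A B Bᴴ D) κ C T = RCLike.re (mix A T).det *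
      ‖(mix ((condKernel A B D T).submatrix κ κ) C).det - (mix (D.submatrix κ κ) C).det‖ ^ 2 := by
    intro C T
    have e1 : (Matrix.fromBlocks A B Bᴴ D).submatrix (Sum.map id κ) (Sum.map id κ) =
        Matrix.fromBlocks A (B.submatrix id κ) (B.submatrix id κ)ᴴ (D.submatrix κ κ) := by
      ext i j; rcases i with i | i <;> rcases j with j | j <;> rfl
    have e2 : condKernel A (B.submatrix id κ) (D.submatrix κ κ) T =
        (condKernel A B D T).submatrix κ κ := rfl
    have e3 : (Matrix.fromBlocks A B Bᴴ D).submatrix Sum.inl Sum.inl = A := rfl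
    have e4 : (Matrix.fromBlocks A B Bᴴ D).submatrix (Sum.inr ∘ κ) (Sum.inr ∘ κ) =
        D.submatrix κ κ := rfl
    have hne : (mix A T).det ≠ 0 := by
      rw [mix_eq_signs_mul_shift, Matrix.det_mul]
      exact ((isUnit_det_signs T).mul (hu T)).ne_zero
    rw [deviation, e1, e3, e4, det_mix_fromBlocks _ _ (hu T), e2, mul_div_cancel_left₀ _ hne]
  simp only [hdev]
  rw [Finset.sum_comm]
  simp only [← Finset.mul_sum]
  have hp : ∀ T, 0 ≤ RCLike.re (mix A T).det := fun T => (RCLike.nonneg_iff.1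
    (Determinantal.det_piecewise_nonneg hA.posSemidef hA'.posSemidef T)).1
  have hw : 0 ≤ min (𝒞.card : ℝ) 2 * Fintype.card k := by positivity
  calc _ ≤ ∑ T, RCLike.re (mix A T).det * (min (𝒞.card : ℝ) 2 * (Fintype.card k *
          ∑ x : k, (condKernel A B D T - D).rowSq (κ x))) := by
        refine Finset.sum_le_sum fun T _ => mul_le_mul_of_nonneg_left ?_ (hp T)
        refine (hDκ.sum_norm_det_mix_sub_sq_le (hRκ T) 𝒞).trans ?_
        rw [← mul_assoc, ← mul_assoc]
        exact mul_le_mul_of_nonneg_left (Finset.sum_le_sum fun x _ =>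
          Matrix.rowSq_submatrix_le (condKernel A B D T - D) κ κ x) hw
    _ = min (𝒞.card : ℝ) 2 * (Fintype.card k * ∑ x : k,
          ∑ T, RCLike.re (mix A T).det * (condKernel A B D T - D).rowSq (κ x)) := by
        rw [Finset.sum_comm]
        simp only [Finset.mul_sum]
        refine Finset.sum_congr rfl fun T _ => Finset.sum_congr rfl fun x _ => ?_
        ring
    _ ≤ _ := by
        rw [← mul_assoc, ← mul_assoc]
        exact mul_le_mul_of_nonneg_left (Finset.sum_le_sum fun x _ =>
          sum_re_det_mix_mul_rowSq_condKernel_sub_le hQ.posSemidef hQ'.posSemidef hA.posSemidef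
            hA'.posSemidef hu (κ x)) hw

theorem Determinantal.continuous_det_mix {X : Type*} [TopologicalSpace X] {Q : X → Matrix f f 𝕜}
    (hQ : Continuous Q) (s : Finset f) : Continuous fun t => (mix (Q t) s).det := by
  refine Continuous.matrix_det (continuous_matrix fun i j => ?_)
  by_cases hi : i ∈ s
  · simpa only [mix, Matrix.of_apply, hi, if_true] using hQ.matrix_elem i j
  · simp only [mix, Matrix.of_apply, hi, if_false, Matrix.sub_apply]
    exact continuous_const.sub (hQ.matrix_elem i j)

theorem Determinantal.sum_deviation_le {Q : Matrix (f ⊕ r) (f ⊕ r) 𝕜} (hQ : Q.PosSemidef)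
    (hQ' : (1 - Q).PosSemidef) (κ : k ↪ r) (𝒞 : Finset (Finset k)) :
    ∑ C ∈ 𝒞, ∑ T, deviation Q κ C T ≤
      min (𝒞.card : ℝ) 2 * (Fintype.card k * ∑ x : k,
        (RCLike.re (Q (Sum.inr (κ x)) (Sum.inr (κ x))) -
          (Q.submatrix Sum.inr Sum.inr).rowSq (κ x))) := by
  -- Moving towards `1/2` times the identity makes both `P t` and `1 - P t` positive definite for `0
  -- < t < 1`.
  let P : ℝ → Matrix (f ⊕ r) (f ⊕ r) 𝕜 := fun t => ((1 - t : ℝ) : 𝕜) • Q + ((t / 2 : ℝ) : 𝕜) • 1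
  have hP : Continuous P := by fun_prop
  have h0 : P 0 = Q := by simp [P]
  -- Configurations of probability zero contribute nothing at `t = 0`, and on the others the
  -- quotient in `deviation` is continuous there. For `t > 0` the omitted terms are nonnegative, so
  -- discarding them is harmless.
  let S : Finset (Finset f) :=
    Finset.univ.filter fun T => (mix (Q.submatrix Sum.inl Sum.inl) T).det ≠ 0
  have hS : ∀ C, ∑ T, deviation Q κ C T = ∑ T ∈ S, deviation Q κ C T := by
    intro C
    refine (Finset.sum_subset (Finset.subset_univ S) fun T _ hT => ?_).symm
    have : (mix (Q.submatrix Sum.inl Sum.inl) T).det = 0 := by simpa [S] using hT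
    rw [deviation, this, map_zero, zero_mul]
  simp only [hS]
  have hlim : Tendsto (fun t => ∑ C ∈ 𝒞, ∑ T ∈ S, deviation (P t) κ C T) (𝓝[>] 0)
      (𝓝 (∑ C ∈ 𝒞, ∑ T ∈ S, deviation Q κ C T)) := by
    refine Tendsto.mono_left ?_ nhdsWithin_le_nhds
    refine tendsto_finsetSum _ fun C _ => tendsto_finsetSum _ fun T hT => ?_
    have hT0 : (mix (Q.submatrix Sum.inl Sum.inl) T).det ≠ 0 := (Finset.mem_filter.1 hT).2
    have c1 := (continuous_det_mix (hP.matrix_submatrix Sum.inl Sum.inl) T).tendsto 0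
    have c2 := (continuous_det_mix (hP.matrix_submatrix (Sum.map id κ) (Sum.map id κ)) (T.disjSum C)).tendsto 0
    have c3 := (continuous_det_mix (hP.matrix_submatrix (Sum.inr ∘ κ) (Sum.inr ∘ κ)) C).tendsto 0
    simp only [h0] at c1 c2 c3
    exact ((RCLike.continuous_re.tendsto _).comp c1).mul
      ((((c2.div c1 hT0).sub c3).norm).pow 2)
  have hrhs : Tendsto (fun t => min (𝒞.card : ℝ) 2 * (Fintype.card k * ∑ x : k,
        (RCLike.re (P t (Sum.inr (κ x)) (Sum.inr (κ x))) -
          ((P t).submatrix Sum.inr Sum.inr).rowSq (κ x)))) (𝓝[>] 0)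
      (𝓝 (min (𝒞.card : ℝ) 2 * (Fintype.card k * ∑ x : k,
        (RCLike.re (Q (Sum.inr (κ x)) (Sum.inr (κ x))) -
          (Q.submatrix Sum.inr Sum.inr).rowSq (κ x))))) := by
    refine Tendsto.mono_left ?_ nhdsWithin_le_nhds
    rw [← h0]
    refine Continuous.tendsto ?_ 0
    refine continuous_const.mul (continuous_const.mul (continuous_finsetSum _ fun x _ => ?_))
    refine (RCLike.continuous_re.comp (hP.matrix_elem _ _)).sub ?_
    exact continuous_finsetSum _ fun y _ => (hP.matrix_elem _ _).norm.pow 2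
  refine le_of_tendsto_of_tendsto hlim hrhs ?_
  filter_upwards [Ioo_mem_nhdsGT (zero_lt_one' ℝ)] with t ht
  have hPt : (P t).PosDef := by
    refine Matrix.PosDef.posSemidef_add ?_ ?_
    · exact hQ.smul (RCLike.ofReal_nonneg.2 (sub_nonneg.2 ht.2.le))
    · exact Matrix.PosDef.one.smul (by simpa using ht.1)
  have hPt' : (1 - P t).PosDef := by
    have : 1 - P t = ((1 - t : ℝ) : 𝕜) • (1 - Q) + ((t / 2 : ℝ) : 𝕜) • 1 := by
      simp only [P]; push_cast; module
    rw [this]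
    refine Matrix.PosDef.posSemidef_add ?_ ?_
    · exact hQ'.smul (RCLike.ofReal_nonneg.2 (sub_nonneg.2 ht.2.le))
    · exact Matrix.PosDef.one.smul (by simpa using ht.1)
  refine le_trans (Finset.sum_le_sum fun C _ => Finset.sum_le_sum_of_subset_of_nonneg
    (Finset.subset_univ S) fun T _ _ => ?_) (sum_deviation_le_of_posDef hPt hPt' κ 𝒞)
  refine mul_nonneg (RCLike.nonneg_iff.1 (det_piecewise_nonneg ?_ ?_ T)).1 (sq_nonneg _)
  · exact hPt.posSemidef.submatrix _
  · exact hPt'.posSemidef.one_sub_submatrix Sum.inl_injective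

end ConditionalVariation

/-! ### Conditional probabilities given a finite partition. -/

section FinitePartition

variable {Ω β : Type*} {m0 : MeasurableSpace Ω} {μ : Measure Ω} [Fintype β] {τ : Ω → β}

theorem integral_comp_fintype [IsFiniteMeasure μ] (hτ : ∀ b, MeasurableSet (τ ⁻¹' {b}))
    (h : β → ℝ) : ∫ ω, h (τ ω) ∂μ = ∑ b, μ.real (τ ⁻¹' {b}) * h b := by
  let _ : MeasurableSpace β := ⊤
  have hm : Measurable τ := measurable_to_countable' hτ
  rw [← integral_map hm.aemeasurable (f := h) (measurable_from_top.aestronglyMeasurable),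
    integral_fintype .of_finite]
  refine Finset.sum_congr rfl fun b _ => ?_
  rw [map_measureReal_apply hm (measurableSet_singleton b), smul_eq_mul]

theorem condExp_comap_fintype_ae_eq [IsProbabilityMeasure μ]
    (hτ : ∀ b, MeasurableSet (τ ⁻¹' {b})) {B : Set Ω} (hB : MeasurableSet B) :
    (fun ω => μ.real (B ∩ τ ⁻¹' {τ ω}) / μ.real (τ ⁻¹' {τ ω})) =ᵐ[μ]
      μ⟦B | MeasurableSpace.comap τ ⊤⟧ := by
  let _ : MeasurableSpace β := ⊤
  have hm : Measurable τ := measurable_to_countable' hτ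
  let h : β → ℝ := fun b => μ.real (B ∩ τ ⁻¹' {b}) / μ.real (τ ⁻¹' {b})
  have hh : Measurable h := measurable_from_top
  refine ae_eq_condExp_of_forall_setIntegral_eq hm.comap_le
    ((integrable_const (1 : ℝ)).indicator hB) ?_ ?_ ?_
  · intro s _ _
    exact ((Integrable.of_finite (f := h) (μ := μ.map τ)).comp_measurable hm).integrableOn
  · rintro _ ⟨S, -, rfl⟩ -
    have h1 := integral_comp_fintype (μ := μ.restrict (τ ⁻¹' S)) hτ h
    rw [h1, setIntegral_indicator hB, setIntegral_const, smul_eq_mul, mul_one,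
      ← measureReal_restrict_apply' hB (μ := μ)]
    have h2 := sum_measureReal_preimage_singleton (μ := μ.restrict B)
      (S.toFinite.toFinset) (f := τ) (fun b _ => hτ b)
    rw [Set.Finite.coe_toFinset] at h2
    rw [← h2, ← Finset.sum_subset (Finset.subset_univ S.toFinite.toFinset)]
    · refine Finset.sum_congr rfl fun b hb => ?_
      have hbS : b ∈ S := by simpa using hb
      have e : τ ⁻¹' {b} ∩ τ ⁻¹' S = τ ⁻¹' {b} := by
        refine Set.inter_eq_left.2 ?_
        rintro ω rfl
        exact hbS
      rw [measureReal_restrict_apply (hτ b), measureReal_restrict_apply (hτ b), e,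
        Set.inter_comm (τ ⁻¹' {b}) B]
      -- On a null atom the quotient takes the default value of division by zero, but its weight and
      -- the intersection both have measure zero.
      by_cases h0 : μ.real (τ ⁻¹' {b}) = 0
      · have h3 : μ.real (B ∩ τ ⁻¹' {b}) ≤ μ.real (τ ⁻¹' {b}) :=
          measureReal_mono Set.inter_subset_right
        rw [h0] at h3 ⊢
        rw [zero_mul, le_antisymm h3 measureReal_nonneg]
      · exact mul_div_cancel₀ _ h0
    · intro b _ hb
      have hbS : b ∉ S := by simpa using hb
      have e : τ ⁻¹' {b} ∩ τ ⁻¹' S = ∅ := by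
        ext ω
        simp only [Set.mem_inter_iff, Set.mem_preimage, Set.mem_singleton_iff,
          Set.mem_empty_iff_false, iff_false]
        rintro ⟨rfl, h⟩
        exact hbS h
      rw [measureReal_restrict_apply (hτ b), e]
      simp
  · exact (hh.comp (comap_measurable τ)).aestronglyMeasurable

theorem integral_condExp_comap_fintype_sub_sq [IsProbabilityMeasure μ]
    (hτ : ∀ b, MeasurableSet (τ ⁻¹' {b})) {B : Set Ω} (hB : MeasurableSet B) (c : ℝ) :
    ∫ ω, ((μ⟦B | MeasurableSpace.comap τ ⊤⟧) ω - c) ^ 2 ∂μ =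
      ∑ b, μ.real (τ ⁻¹' {b}) * (μ.real (B ∩ τ ⁻¹' {b}) / μ.real (τ ⁻¹' {b}) - c) ^ 2 := by
  rw [← integral_comp_fintype hτ
    fun b => (μ.real (B ∩ τ ⁻¹' {b}) / μ.real (τ ⁻¹' {b}) - c) ^ 2]
  refine integral_congr_ae ?_
  filter_upwards [condExp_comap_fintype_ae_eq hτ hB] with ω hω
  rw [← hω]

end FinitePartition

/-! ### Traces on finite sets and elementary probabilities. -/

section Trace

open Classical in
/-- The trace of a set on a finite family of points. -/
noncomputable def Set.traceOn {n E : Type*} [Fintype n] (ι : n → E) (S : Set E) : Finset n :=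
  Finset.univ.filter fun i => ι i ∈ S

theorem Set.mem_traceOn {n E : Type*} [Fintype n] {ι : n → E} {S : Set E} {i : n} :
    i ∈ S.traceOn ι ↔ ι i ∈ S := by
  simp [Set.traceOn]

theorem cylSigma_range {n E : Type*} [Fintype n] (ι : n → E) :
    cylSigma (Set.range ι) = MeasurableSpace.comap (Set.traceOn ι) ⊤ := by
  refine le_antisymm ?_ ?_
  · refine MeasurableSpace.generateFrom_le ?_
    rintro _ ⟨_, ⟨i, rfl⟩, rfl⟩
    refine ⟨{s | i ∈ s}, trivial, ?_⟩
    ext S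
    exact Set.mem_traceOn
  · classical
    let _ : MeasurableSpace (Finset n) := ⊤
    refine measurable_iff_comap_le.1 ?_
    refine @measurable_to_countable' _ _ _ _ (cylSigma (Set.range ι)) _ fun s => ?_
    have hi : ∀ i, MeasurableSet[cylSigma (Set.range ι)] {S : Set E | ι i ∈ S} := fun i =>
      MeasurableSpace.measurableSet_generateFrom ⟨ι i, ⟨i, rfl⟩, rfl⟩
    have e : Set.traceOn ι ⁻¹' {s} =
        ⋂ i, if i ∈ s then {S : Set E | ι i ∈ S} else {S : Set E | ι i ∈ S}ᶜ := by
      ext S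
      simp only [Set.mem_preimage, Set.mem_singleton_iff, Set.mem_iInter, Finset.ext_iff,
        Set.mem_traceOn]
      refine forall_congr' fun i => ?_
      by_cases h : i ∈ s <;> simp [h]
    rw [e]
    refine @MeasurableSet.iInter _ _ (cylSigma (Set.range ι)) _ _ fun i => ?_
    split_ifs
    · exact hi i
    · exact @MeasurableSet.compl _ _ (cylSigma (Set.range ι)) (hi i)

theorem measurableSet_traceOn_preimage {n E : Type*} [Fintype n] (ι : n → E)
    (𝒮 : Set (Finset n)) : MeasurableSet (Set.traceOn ι ⁻¹' 𝒮) := by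
  refine cylSigma_le (Set.range ι) _ ?_
  rw [cylSigma_range]
  exact ⟨𝒮, trivial, rfl⟩

end Trace

/-- Möbius inversion by induction from large sets down: once the strict supersets of `A` are
settled, only the term `s = A` remains. It recovers elementary probabilities from inclusion
probabilities. -/
theorem Finset.eq_of_sum_superset_eq {n M : Type*} [Fintype n] [DecidableEq n] [AddCommGroup M]
    {a b : Finset n → M}
    (h : ∀ A : Finset n, ∑ s, (if A ⊆ s then a s else 0) = ∑ s, if A ⊆ s then b s else 0) :
    a = b := by
  funext A
  induction A using (wellFounded_gt (α := Finset n)).induction with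
  | _ A ih =>
    have h1 := h A
    rw [← Finset.add_sum_erase _ _ (Finset.mem_univ A),
      ← Finset.add_sum_erase _ (fun s => if A ⊆ s then b s else 0) (Finset.mem_univ A)] at h1
    have h2 : ∑ s ∈ Finset.univ.erase A, (if A ⊆ s then a s else 0) =
        ∑ s ∈ Finset.univ.erase A, if A ⊆ s then b s else 0 := by
      refine Finset.sum_congr rfl fun s hs => ?_
      by_cases hAs : A ⊆ s
      · rw [if_pos hAs, if_pos hAs]
        exact ih s (Finset.ssubset_iff_subset_ne.2 ⟨hAs, (Finset.ne_of_mem_erase hs).symm⟩)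
      · rw [if_neg hAs, if_neg hAs]
    rw [h2] at h1
    simpa using add_right_cancel h1

/-- The elementary probabilities of a determinantal measure. -/
theorem IsDeterminantal.ofReal_real_traceOn {𝕜 E n : Type*} [RCLike 𝕜] [DecidableEq E] [Fintype n]
    [DecidableEq n] {Q : Matrix E E 𝕜} {P : Measure (Set E)} (h : IsDeterminantal Q P)
    (ι : n ↪ E) (s : Finset n) :
    ((P.real (Set.traceOn ι ⁻¹' {s}) : ℝ) : 𝕜) =
      (Determinantal.mix (Q.submatrix ι ι) s).det := by
  obtain ⟨hP, h⟩ := h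
  refine congrFun (Finset.eq_of_sum_superset_eq
    (a := fun s => ((P.real (Set.traceOn ι ⁻¹' {s}) : ℝ) : 𝕜))
    (b := fun s => (Determinantal.mix (Q.submatrix ι ι) s).det) fun A => ?_) s
  rw [Determinantal.sum_det_piecewise]
  have h1 : {B : Set E | ((A.map ι : Finset E) : Set E) ⊆ B} = Set.traceOn ι ⁻¹'
      ((Finset.univ.filter fun s => A ⊆ s : Finset (Finset n)) : Set (Finset n)) := by
    ext B
    simp [Set.subset_def, Finset.subset_iff, Set.mem_traceOn]
  have h2 := h (A.map ι)
  rw [h1, ← sum_measureReal_preimage_singleton _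
    (fun s _ => measurableSet_traceOn_preimage ι {s})] at h2
  rw [← Finset.sum_filter, ← RCLike.ofReal_sum, h2]
  let e : A ≃ A.map ι :=
    { toFun := fun a => ⟨ι a, Finset.mem_map_of_mem _ a.2⟩
      invFun := fun b => ⟨(Finset.mem_map.1 b.2).choose, (Finset.mem_map.1 b.2).choose_spec.1⟩
      left_inv := fun a => by
        ext
        exact ι.injective (Finset.mem_map.1 (Finset.mem_map_of_mem ι a.2)).choose_spec.2
      right_inv := fun b => by
        ext
        exact (Finset.mem_map.1 b.2).choose_spec.2 }
  rw [← Matrix.det_submatrix_equiv_self e]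
  rfl

/-! ### The matrix of an orthogonal projection. -/

section ProjMatrix

open scoped ComplexOrder

variable {𝕜 E : Type*} [RCLike 𝕜]

theorem inner_proj_left (H : ClosedSubmodule 𝕜 (L2 𝕜 E)) (u v : L2 𝕜 E) :
    inner 𝕜 (proj H u) v = inner 𝕜 u (proj H v) := by
  have : CompleteSpace H.toSubmodule := H.isClosed.completeSpace_coe
  exact Submodule.inner_starProjection_left_eq_right _ _ _

theorem proj_proj (H : ClosedSubmodule 𝕜 (L2 𝕜 E)) (v : L2 𝕜 E) :
    proj H (proj H v) = proj H v := by
  have : CompleteSpace H.toSubmodule := H.isClosed.completeSpace_coe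
  exact Submodule.starProjection_eq_self_iff.2 (Submodule.starProjection_apply_mem _ _)

theorem proj_of_mem {H : ClosedSubmodule 𝕜 (L2 𝕜 E)} {v : L2 𝕜 E} (hv : v ∈ H) :
    proj H v = v := by
  have : CompleteSpace H.toSubmodule := H.isClosed.completeSpace_coe
  exact Submodule.starProjection_eq_self_iff.2 hv

theorem hasSum_norm_sq (v : L2 𝕜 E) : HasSum (fun i => ‖v i‖ ^ 2) (‖v‖ ^ 2) := by
  have := lp.hasSum_norm (p := 2) (by simp) v
  simpa using this

variable [DecidableEq E]

theorem inner_stdVec_left (e : E) (v : L2 𝕜 E) : inner 𝕜 (stdVec 𝕜 e) v = v e := by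
  rw [stdVec, lp.inner_single_left]
  simp

theorem stdVec_apply (i j : E) : stdVec 𝕜 i j = if i = j then 1 else 0 := by
  by_cases h : i = j
  · subst h; simp [stdVec]
  · rw [if_neg h, stdVec]
    exact lp.single_apply_ne 2 i _ (Ne.symm h)

theorem posSemidef_projMatrix_submatrix (H : ClosedSubmodule 𝕜 (L2 𝕜 E)) {n : Type*} [Finite n]
    (g : n → E) : ((projMatrix H).submatrix g g).PosSemidef := by
  have : (projMatrix H).submatrix g g = Matrix.gram 𝕜 fun i => proj H (stdVec 𝕜 (g i)) := by
    ext i j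
    rw [Matrix.gram_apply, inner_proj_left, proj_proj]
    rfl
  rw [this]
  exact Matrix.posSemidef_gram 𝕜 _

theorem posSemidef_one_sub_projMatrix_submatrix (H : ClosedSubmodule 𝕜 (L2 𝕜 E)) {n : Type*}
    [Finite n] [DecidableEq n] (g : n ↪ E) :
    (1 - (projMatrix H).submatrix g g).PosSemidef := by
  have : 1 - (projMatrix H).submatrix g g =
      Matrix.gram 𝕜 fun i => stdVec 𝕜 (g i) - proj H (stdVec 𝕜 (g i)) := by
    ext i j
    rw [Matrix.gram_apply, inner_sub_left, inner_sub_right, inner_sub_right, inner_proj_left,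
      inner_proj_left, proj_proj, sub_self, sub_zero, inner_stdVec_left, stdVec_apply,
      Matrix.sub_apply, Matrix.one_apply]
    simp only [projMatrix, Matrix.submatrix_apply, Matrix.of_apply, g.injective.eq_iff,
      eq_comm (a := j)]
  rw [this]
  exact Matrix.posSemidef_gram 𝕜 _

theorem projMatrix_apply (H : ClosedSubmodule 𝕜 (L2 𝕜 E)) (i j : E) :
    projMatrix H i j = proj H (stdVec 𝕜 j) i := inner_stdVec_left _ _

theorem re_projMatrix_self (H : ClosedSubmodule 𝕜 (L2 𝕜 E)) (x : E) :
    RCLike.re (projMatrix H x x) = ‖proj H (stdVec 𝕜 x)‖ ^ 2 := by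
  rw [← inner_self_eq_norm_sq (𝕜 := 𝕜), inner_proj_left, proj_proj]
  rfl

theorem norm_projMatrix_comm (H : ClosedSubmodule 𝕜 (L2 𝕜 E)) (i j : E) :
    ‖projMatrix H i j‖ = ‖projMatrix H j i‖ := by
  rw [projMatrix, Matrix.of_apply, Matrix.of_apply, ← inner_proj_left, norm_inner_symm]

/-- Idempotence of the projection enters here: the part of a diagonal entry not carried by a set of
columns is the mass of its row on the remaining columns. -/
theorem hasSum_norm_projMatrix_sq (H : ClosedSubmodule 𝕜 (L2 𝕜 E)) (x : E) :
    HasSum (fun y => ‖projMatrix H x y‖ ^ 2) (RCLike.re (projMatrix H x x)) := by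
  rw [re_projMatrix_self]
  convert hasSum_norm_sq (proj H (stdVec 𝕜 x)) using 3 with y
  rw [norm_projMatrix_comm, projMatrix_apply]

/-- Projecting onto `[F]` leaves the coordinates in `F` unchanged. -/
theorem sum_norm_sq_le_norm_proj_coordSubspace {F : Set E} {s : Finset E} (hs : ↑s ⊆ F)
    (v : L2 𝕜 E) : ∑ y ∈ s, ‖v y‖ ^ 2 ≤ ‖proj (coordSubspace 𝕜 F) v‖ ^ 2 := by
  have h : ∀ y ∈ s, v y = proj (coordSubspace 𝕜 F) v y := by
    intro y hy
    have hmem : stdVec 𝕜 y ∈ coordSubspace 𝕜 F :=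
      subset_closure (Submodule.subset_span ⟨y, hs hy, rfl⟩)
    rw [← inner_stdVec_left, ← inner_stdVec_left, ← inner_proj_left, proj_of_mem hmem]
  rw [Finset.sum_congr rfl fun y hy => by rw [h y hy]]
  exact sum_le_hasSum s (fun _ _ => sq_nonneg _) (hasSum_norm_sq _)

theorem sum_sum_norm_projMatrix_sq_le (H : ClosedSubmodule 𝕜 (L2 𝕜 E)) {F : Set E}
    {s : Finset E} (hs : ↑s ⊆ F) (K : Finset E) :
    ∑ x ∈ K, ∑ y ∈ s, ‖projMatrix H x y‖ ^ 2 ≤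
      ∑ x ∈ K, ‖proj (coordSubspace 𝕜 F) (proj H (stdVec 𝕜 x))‖ ^ 2 := by
  refine Finset.sum_le_sum fun x _ => le_trans (le_of_eq ?_)
    (sum_norm_sq_le_norm_proj_coordSubspace hs (proj H (stdVec 𝕜 x)))
  refine Finset.sum_congr rfl fun y _ => ?_
  rw [norm_projMatrix_comm, projMatrix_apply]

end ProjMatrix

/-! ### The variance bound for finite `F`. -/

section ConditionalVariance

/-- The event that the trace of the random set on `K` is `C`. -/
def traceEvent {E : Type*} (K : Finset E) (C : Finset K) : Set (Set E) :=
  Set.traceOn ((↑) : K → E) ⁻¹' {C}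

theorem measurableSet_traceEvent {E : Type*} (K : Finset E) (C : Finset K) :
    MeasurableSet (traceEvent K C) := measurableSet_traceOn_preimage _ _

variable {𝕜 E : Type*} [RCLike 𝕜] [DecidableEq E] [Countable E]

instance isProbabilityMeasure_detMeasure (H : ClosedSubmodule 𝕜 (L2 𝕜 E)) :
    IsProbabilityMeasure (detMeasure H) := (isDeterminantal_detMeasure H).1

/-- The finite window `G` around `K` occurs only on the right, so it may later be enlarged freely.
-/
theorem sum_integral_condExp_sub_sq_le_of_subset (H : ClosedSubmodule 𝕜 (L2 𝕜 E))
    {F K G : Finset E} (hFG : Disjoint F G) (hKG : K ⊆ G) (𝒞 : Finset (Finset K)) :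
    ∑ C ∈ 𝒞, ∫ S, (((detMeasure H)⟦traceEvent K C | cylSigma (F : Set E)⟧) S -
        (detMeasure H).real (traceEvent K C)) ^ 2 ∂(detMeasure H) ≤
      min (𝒞.card : ℝ) 2 * (K.card * ∑ x ∈ K,
        (RCLike.re (projMatrix H x x) - ∑ y ∈ G, ‖projMatrix H x y‖ ^ 2)) := by
  have hι : Function.Injective (Sum.elim ((↑) : F → E) ((↑) : G → E)) :=
    Subtype.val_injective.sumElim Subtype.val_injective fun a b hab =>
      Finset.disjoint_left.1 hFG a.2 (hab ▸ b.2)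
  let ι : F ⊕ G ↪ E := ⟨_, hι⟩
  let κ : K ↪ G := ⟨fun x => ⟨x, hKG x.2⟩, fun x y h =>
    Subtype.ext (congrArg (fun z : G => (z : E)) h)⟩
  let ιK : F ⊕ K ↪ E := ⟨ι ∘ Sum.map id κ, ι.injective.comp
    (Sum.map_injective.2 ⟨Function.injective_id, κ.injective⟩)⟩
  have hdet := isDeterminantal_detMeasure H
  have hsigma : cylSigma (F : Set E) =
      MeasurableSpace.comap (Set.traceOn ((↑) : F → E)) ⊤ := by
    rw [← cylSigma_range, Subtype.range_coe]
  have hF : ∀ T : Finset F, (((detMeasure H).real (traceEvent F T) : ℝ) : 𝕜) =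
      (Determinantal.mix (((projMatrix H).submatrix ι ι).submatrix Sum.inl Sum.inl) T).det :=
    fun T => hdet.ofReal_real_traceOn (Function.Embedding.subtype _) T
  have hK : ∀ C : Finset K, (((detMeasure H).real (traceEvent K C) : ℝ) : 𝕜) =
      (Determinantal.mix (((projMatrix H).submatrix ι ι).submatrix
        (Sum.inr ∘ κ) (Sum.inr ∘ κ)) C).det :=
    fun C => hdet.ofReal_real_traceOn (Function.Embedding.subtype _) C
  have hFK : ∀ (T : Finset F) (C : Finset K),
      (((detMeasure H).real (traceEvent K C ∩ traceEvent F T) : ℝ) : 𝕜) =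
      (Determinantal.mix (((projMatrix H).submatrix ι ι).submatrix
        (Sum.map id κ) (Sum.map id κ)) (T.disjSum C)).det := by
    intro T C
    refine Eq.trans ?_ (hdet.ofReal_real_traceOn ιK (T.disjSum C))
    congr 2
    ext S
    simp only [traceEvent, Set.mem_inter_iff, Set.mem_preimage, Set.mem_singleton_iff,
      Finset.ext_iff, Sum.forall, Set.mem_traceOn, Finset.inl_mem_disjSum, Finset.inr_mem_disjSum]
    exact and_comm
  have hdev : ∀ C : Finset K, ∫ S, (((detMeasure H)⟦traceEvent K C | cylSigma (F : Set E)⟧) S -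
        (detMeasure H).real (traceEvent K C)) ^ 2 ∂(detMeasure H) =
      ∑ T, Determinantal.deviation ((projMatrix H).submatrix ι ι) κ C T := by
    intro C
    rw [hsigma, integral_condExp_comap_fintype_sub_sq
      (fun T => measurableSet_traceEvent F T) (measurableSet_traceEvent K C)]
    refine Finset.sum_congr rfl fun T _ => ?_
    rw [Determinantal.deviation, ← hF, ← hK, ← hFK, RCLike.ofReal_re, ← RCLike.ofReal_div,
      ← RCLike.ofReal_sub, RCLike.norm_ofReal, sq_abs]
    rfl
  rw [Finset.sum_congr rfl fun C _ => hdev C]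
  refine (Determinantal.sum_deviation_le (posSemidef_projMatrix_submatrix H ι)
    (posSemidef_one_sub_projMatrix_submatrix H ι) κ 𝒞).trans_eq ?_
  rw [Fintype.card_coe, ← Finset.sum_coe_sort K]
  congr 2
  refine Finset.sum_congr rfl fun x _ => ?_
  rw [← Finset.sum_coe_sort G]
  rfl

/-- The window is `U \ F` with `U` increasing to `E`. The diagonal entry minus the row mass on the
window then tends to the row mass on `F`. -/
theorem sum_integral_condExp_sub_sq_le_of_finset (H : ClosedSubmodule 𝕜 (L2 𝕜 E))
    {F K : Finset E} (hFK : Disjoint F K) (𝒞 : Finset (Finset K)) :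
    ∑ C ∈ 𝒞, ∫ S, (((detMeasure H)⟦traceEvent K C | cylSigma (F : Set E)⟧) S -
        (detMeasure H).real (traceEvent K C)) ^ 2 ∂(detMeasure H) ≤
      min (𝒞.card : ℝ) 2 * (K.card * ∑ x ∈ K, ∑ y ∈ F, ‖projMatrix H x y‖ ^ 2) := by
  have hlim : Tendsto (fun U : Finset E => min (𝒞.card : ℝ) 2 * (K.card * ∑ x ∈ K,
        (RCLike.re (projMatrix H x x) -
          (∑ y ∈ U, ‖projMatrix H x y‖ ^ 2 - ∑ y ∈ F, ‖projMatrix H x y‖ ^ 2)))) atTop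
      (𝓝 (min (𝒞.card : ℝ) 2 * (K.card * ∑ x ∈ K, (RCLike.re (projMatrix H x x) -
          (RCLike.re (projMatrix H x x) - ∑ y ∈ F, ‖projMatrix H x y‖ ^ 2))))) := by
    refine (Tendsto.const_mul _ (tendsto_finsetSum _ fun x _ => ?_)).const_mul _
    exact ((hasSum_norm_projMatrix_sq H x).sub_const _).const_sub _
  simp only [sub_sub_cancel] at hlim
  refine ge_of_tendsto hlim ?_
  filter_upwards [eventually_ge_atTop (F ∪ K)] with U hU
  have hFU : F ⊆ U := Finset.union_subset_left hU
  have hKU : K ⊆ U \ F := fun x hx => Finset.mem_sdiff.2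
    ⟨Finset.union_subset_right hU hx, fun h => Finset.disjoint_left.1 hFK h hx⟩
  refine (sum_integral_condExp_sub_sq_le_of_subset H Finset.disjoint_sdiff hKU 𝒞).trans_eq ?_
  congr 2
  refine Finset.sum_congr rfl fun x _ => ?_
  rw [Finset.sum_sdiff_eq_sub hFU]

end ConditionalVariance

/-! ### Passage to infinite `F` by martingale convergence. -/

section Levy

theorem cylSigma_mono {E : Type*} {F F' : Set E} (h : F ⊆ F') : cylSigma F ≤ cylSigma F' :=
  MeasurableSpace.generateFrom_mono fun _ ⟨e, he, hs⟩ => ⟨e, h he, hs⟩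

theorem condExp_indicator_mem_Icc {Ω : Type*} {m m0 : MeasurableSpace Ω} {μ : Measure Ω}
    [IsProbabilityMeasure μ] (hm : m ≤ m0) {B : Set Ω} (hB : MeasurableSet B) :
    ∀ᵐ ω ∂μ, (μ⟦B | m⟧) ω ∈ Set.Icc (0 : ℝ) 1 := by
  have hi : Integrable (B.indicator fun _ => (1 : ℝ)) μ := (integrable_const 1).indicator hB
  have h0 : 0 ≤ᵐ[μ] μ⟦B | m⟧ := condExp_nonneg <| Eventually.of_forall fun ω =>
    Set.indicator_nonneg (fun _ _ => zero_le_one) ω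
  have h1 : μ⟦B | m⟧ ≤ᵐ[μ] μ[fun _ => (1 : ℝ) | m] := condExp_mono hi (integrable_const 1) <|
    Eventually.of_forall fun ω => Set.indicator_le_self' (fun _ _ => zero_le_one) ω
  rw [condExp_const hm] at h1
  filter_upwards [h0, h1] with ω h0 h1 using ⟨h0, h1⟩

theorem integrable_condExp_indicator_sub_sq {Ω : Type*} {m m0 : MeasurableSpace Ω}
    {μ : Measure Ω} [IsProbabilityMeasure μ] (hm : m ≤ m0) {B : Set Ω} (hB : MeasurableSet B)
    (c : ℝ) : Integrable (fun ω => ((μ⟦B | m⟧) ω - c) ^ 2) μ := by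
  have hmeas : AEStronglyMeasurable (fun ω => ((μ⟦B | m⟧) ω - c) ^ 2) μ :=
    ((stronglyMeasurable_condExp.mono hm).sub stronglyMeasurable_const).pow 2 |>.aestronglyMeasurable
  refine Integrable.of_bound hmeas ((1 + |c|) ^ 2) ?_
  filter_upwards [condExp_indicator_mem_Icc hm hB] with ω hω
  rw [norm_pow, Real.norm_eq_abs]
  refine pow_le_pow_left₀ (abs_nonneg _) ((abs_sub _ _).trans ?_) 2
  rw [abs_of_nonneg hω.1]
  linarith [hω.2]

/-- Lévy's upward theorem gives almost sure convergence; conditional probabilities lie in `[0, 1]`,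
so `(1 + |c|) ^ 2` dominates. -/
theorem tendsto_integral_condExp_sub_sq {E : Type*} {P : Measure (Set E)} [IsProbabilityMeasure P]
    {B : Set (Set E)} (hB : MeasurableSet B) {F : ℕ → Set E} (hF : Monotone F) (c : ℝ) :
    Tendsto (fun n => ∫ S, ((P⟦B | cylSigma (F n)⟧) S - c) ^ 2 ∂P) atTop
      (𝓝 (∫ S, ((P⟦B | cylSigma (⋃ n, F n)⟧) S - c) ^ 2 ∂P)) := by
  let ℱ : Filtration ℕ (Set.instMeasurableSpace (α := E)) :=
    ⟨fun n => cylSigma (F n), fun _ _ h => cylSigma_mono (hF h), fun n => cylSigma_le (F n)⟩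
  have hsup : (⨆ n, ℱ n) = cylSigma (⋃ n, F n) := by
    refine le_antisymm (iSup_le fun n => cylSigma_mono (Set.subset_iUnion F n)) ?_
    refine MeasurableSpace.generateFrom_le ?_
    rintro _ ⟨e, he, rfl⟩
    obtain ⟨n, hn⟩ := Set.mem_iUnion.1 he
    exact le_iSup (fun n => ℱ n) n _ (MeasurableSpace.measurableSet_generateFrom ⟨e, hn, rfl⟩)
  have hae := tendsto_ae_condExp (μ := P) (ℱ := ℱ) (B.indicator fun _ => (1 : ℝ))
  rw [hsup] at hae
  refine tendsto_integral_of_dominated_convergence (fun _ => (1 + |c|) ^ 2)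
    (fun n => (integrable_condExp_indicator_sub_sq (cylSigma_le (F n)) hB c).aestronglyMeasurable)
    (integrable_const _) (fun n => ?_) ?_
  · filter_upwards [condExp_indicator_mem_Icc (cylSigma_le (F n)) hB] with ω hω
    rw [norm_pow, Real.norm_eq_abs]
    refine pow_le_pow_left₀ (abs_nonneg _) ((abs_sub _ _).trans ?_) 2
    rw [abs_of_nonneg hω.1]
    linarith [hω.2]
  · filter_upwards [hae] with ω hω
    exact (hω.sub_const c).pow 2

end Levy

/-! ### The general variance bound and the covariance estimate. -/

section Main

variable {𝕜 E : Type*} [RCLike 𝕜] [DecidableEq E] [Countable E]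

theorem sum_integral_condExp_sub_sq_le (H : ClosedSubmodule 𝕜 (L2 𝕜 E)) {F : Set E}
    {K : Finset E} (hFK : Disjoint F (K : Set E)) (𝒞 : Finset (Finset K)) :
    ∑ C ∈ 𝒞, ∫ S, (((detMeasure H)⟦traceEvent K C | cylSigma F⟧) S -
        (detMeasure H).real (traceEvent K C)) ^ 2 ∂(detMeasure H) ≤
      min (𝒞.card : ℝ) 2 * (K.card *
        ∑ x ∈ K, ‖proj (coordSubspace 𝕜 F) (proj H (stdVec 𝕜 x))‖ ^ 2) := by
  -- An injection into `ℕ` exhausts `F` by the finite sets of points with label below `n`.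
  obtain ⟨g, hg⟩ := exists_injective_nat E
  have hfin : ∀ n, {e ∈ F | g e < n}.Finite := fun n =>
    ((Set.finite_lt_nat n).preimage hg.injOn).subset fun e he => he.2
  let Fs : ℕ → Set E := fun n => {e ∈ F | g e < n}
  have hmono : Monotone Fs := fun m n h e he => ⟨he.1, he.2.trans_le h⟩
  have hU : ⋃ n, Fs n = F := by
    ext e
    simp only [Fs, Set.mem_iUnion]
    exact ⟨fun ⟨_, h⟩ => h.1, fun h => ⟨g e + 1, h, Nat.lt_succ_self _⟩⟩
  have hlim := tendsto_finsetSum 𝒞 fun C _ => tendsto_integral_condExp_sub_sq (P := detMeasure H)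
    (measurableSet_traceEvent K C) hmono ((detMeasure H).real (traceEvent K C))
  rw [hU] at hlim
  refine le_of_tendsto' hlim fun n => ?_
  have hc : ((hfin n).toFinset : Set E) = Fs n := (hfin n).coe_toFinset
  have hsub : ((hfin n).toFinset : Set E) ⊆ F := by
    rw [hc]
    exact fun e he => he.1
  rw [← hc]
  have hdisj : Disjoint (hfin n).toFinset K := by
    rw [← Finset.disjoint_coe]
    exact hFK.mono_left hsub
  refine (sum_integral_condExp_sub_sq_le_of_finset H hdisj 𝒞).trans ?_
  exact mul_le_mul_of_nonneg_left (mul_le_mul_of_nonneg_left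
    (sum_sum_norm_projMatrix_sq_le H hsub K) (Nat.cast_nonneg _)) (by positivity)

theorem variance_condExp_indicator {Ω : Type*} {m m0 : MeasurableSpace Ω} {μ : Measure Ω}
    [IsProbabilityMeasure μ] (hm : m ≤ m0) {B : Set Ω} (hB : MeasurableSet B) :
    variance (μ⟦B | m⟧) μ = ∫ ω, ((μ⟦B | m⟧) ω - μ.real B) ^ 2 ∂μ := by
  rw [variance_eq_integral ((stronglyMeasurable_condExp.mono hm).measurable.aemeasurable),
    integral_condExp hm, integral_indicator hB, setIntegral_const, smul_eq_mul, mul_one]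

/-- The covariance of an event with a `σ`-field, in terms of conditional probabilities. -/
theorem abs_sum_measureReal_inter_sub_mul_le {Ω ι : Type*} {m m0 : MeasurableSpace Ω}
    {μ : Measure Ω} [IsProbabilityMeasure μ] (hm : m ≤ m0) {A : Set Ω} (hA : MeasurableSet[m] A)
    (s : Finset ι) {B : ι → Set Ω} (hB : ∀ i, MeasurableSet (B i)) :
    |∑ i ∈ s, (μ.real (B i ∩ A) - μ.real (B i) * μ.real A)| ≤
      Real.sqrt (s.card * ∑ i ∈ s, ∫ ω, ((μ⟦B i | m⟧) ω - μ.real (B i)) ^ 2 ∂μ) / 2 := by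
  let Y : ι → Ω → ℝ := fun i ω => (μ⟦B i | m⟧) ω - μ.real (B i)
  have hYi : ∀ i, Integrable (Y i) μ := fun i => integrable_condExp.sub (integrable_const _)
  have hY2 : ∀ i, Integrable (fun ω => Y i ω ^ 2) μ := fun i =>
    integrable_condExp_indicator_sub_sq hm (hB i) _
  have hind : ∀ i, Integrable ((B i).indicator fun _ => (1 : ℝ)) μ := fun i =>
    (integrable_const 1).indicator (hB i)
  have hA' : MeasurableSet A := hm _ hA
  let Z : Ω → ℝ := fun ω => ∑ i ∈ s, Y i ω
  have hZi : Integrable Z μ := integrable_finsetSum _ fun i _ => hYi i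
  have hZ2 : ∀ ω, Z ω ^ 2 ≤ s.card * ∑ i ∈ s, Y i ω ^ 2 := fun ω => sq_sum_le_card_mul_sum_sq
  have hsum2 : Integrable (fun ω => (s.card : ℝ) * ∑ i ∈ s, Y i ω ^ 2) μ :=
    (integrable_finsetSum _ fun i _ => hY2 i).const_mul _
  have hZ2i : Integrable (fun ω => Z ω ^ 2) μ := by
    refine hsum2.mono' (hZi.aestronglyMeasurable.pow 2) (Eventually.of_forall fun ω => ?_)
    rw [Real.norm_eq_abs, abs_of_nonneg (sq_nonneg _)]
    exact hZ2 ω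
  have hset : ∀ i, ∫ ω in A, Y i ω ∂μ = μ.real (B i ∩ A) - μ.real (B i) * μ.real A := by
    intro i
    rw [integral_sub integrable_condExp.integrableOn (integrable_const _),
      setIntegral_condExp hm (hind i) hA, setIntegral_indicator (hB i), setIntegral_const,
      setIntegral_const, smul_eq_mul, smul_eq_mul, mul_one, Set.inter_comm, mul_comm]
  have hzero : ∀ i, ∫ ω, Y i ω ∂μ = 0 := by
    intro i
    rw [integral_sub integrable_condExp (integrable_const _), integral_condExp hm,
      integral_indicator (hB i), setIntegral_const, integral_const]
    simp
  -- Since `Z` has mean zero, `1/2` may be subtracted from the indicator of `A`. The difference has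
  -- absolute value exactly `1/2`, whence the halving in the bound.
  have h1 : ∑ i ∈ s, (μ.real (B i ∩ A) - μ.real (B i) * μ.real A) =
      ∫ ω, (A.indicator (fun _ => (1 : ℝ)) ω - 1 / 2) * Z ω ∂μ := by
    have e : ∀ ω, (A.indicator (fun _ => (1 : ℝ)) ω - 1 / 2) * Z ω =
        A.indicator Z ω - 1 / 2 * Z ω := by
      intro ω
      by_cases h : ω ∈ A
      · simp only [Set.indicator_of_mem h]; ring
      · simp only [Set.indicator_of_notMem h]; ring
    simp only [e]
    rw [integral_sub (hZi.indicator hA') (hZi.const_mul _), integral_const_mul,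
      integral_indicator hA', integral_finsetSum _ fun i _ => (hYi i).integrableOn,
      integral_finsetSum _ fun i _ => hYi i]
    simp only [hset, hzero]
    simp
  have h2 : |∫ ω, (A.indicator (fun _ => (1 : ℝ)) ω - 1 / 2) * Z ω ∂μ| ≤
      1 / 2 * ∫ ω, |Z ω| ∂μ := by
    rw [← integral_const_mul, ← Real.norm_eq_abs]
    refine norm_integral_le_of_norm_le (hZi.abs.const_mul _) (Eventually.of_forall fun ω => ?_)
    rw [norm_mul, Real.norm_eq_abs, Real.norm_eq_abs]
    refine mul_le_mul_of_nonneg_right ?_ (abs_nonneg _)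
    by_cases h : ω ∈ A
    · rw [Set.indicator_of_mem h]; norm_num
    · rw [Set.indicator_of_notMem h]; norm_num
  -- Jensen's inequality, read off from the nonnegativity of the variance of `|Z|`.
  have h3 : (∫ ω, |Z ω| ∂μ) ^ 2 ≤ ∫ ω, Z ω ^ 2 ∂μ := by
    have hm2 : MemLp (fun ω => |Z ω|) 2 μ := by
      rw [memLp_two_iff_integrable_sq hZi.abs.aestronglyMeasurable]
      simpa only [sq_abs] using hZ2i
    have := variance_nonneg (fun ω => |Z ω|) μ
    rw [variance_eq_sub hm2] at this
    simp only [Pi.pow_apply, sq_abs] at this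
    linarith
  have h4 : ∫ ω, Z ω ^ 2 ∂μ ≤ s.card * ∑ i ∈ s, ∫ ω, Y i ω ^ 2 ∂μ := by
    rw [← integral_finsetSum _ fun i _ => hY2 i, ← integral_const_mul]
    exact integral_mono hZ2i hsum2 hZ2
  rw [h1]
  have h5 := Real.le_sqrt_of_sq_le (h3.trans h4)
  linarith

end Main

theorem mainTheorem7 {𝕜 E : Type*} [RCLike 𝕜] [DecidableEq E] [Countable E]
    (H : ClosedSubmodule 𝕜 (L2 𝕜 E)) (F : Set E) (K : Finset E)
    (hFK : Disjoint F (K : Set E)) :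
    (∀ C : Finset E, C ⊆ K →
      variance ((detMeasure H)⟦{B : Set E | B ∩ (K : Set E) = (C : Set E)} | cylSigma F⟧)
          (detMeasure H) ≤
        (K.card : ℝ) * ∑ e ∈ K, ‖proj (coordSubspace 𝕜 F) (proj H (stdVec 𝕜 e))‖ ^ 2) ∧
    (∀ A₁ A₂ : Set (Set E),
      MeasurableSet[cylSigma (K : Set E)] A₁ → MeasurableSet[cylSigma F] A₂ →
      |(detMeasure H).real (A₁ ∩ A₂) - (detMeasure H).real A₁ * (detMeasure H).real A₂| ≤
        Real.sqrt ((2 : ℝ) ^ K.card * (K.card : ℝ) *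
          ∑ e ∈ K, ‖proj (coordSubspace 𝕜 F) (proj H (stdVec 𝕜 e))‖ ^ 2)) := by
  set V : ℝ := ∑ e ∈ K, ‖proj (coordSubspace 𝕜 F) (proj H (stdVec 𝕜 e))‖ ^ 2 with hV
  have hV0 : 0 ≤ V := Finset.sum_nonneg fun _ _ => sq_nonneg _
  refine ⟨fun C hC => ?_, fun A₁ A₂ hA₁ hA₂ => ?_⟩
  · have e : {B : Set E | B ∩ (K : Set E) = (C : Set E)} =
        traceEvent K (C.subtype fun x => x ∈ K) := by
      ext B
      simp only [traceEvent, Set.mem_ofPred_eq, Set.mem_preimage, Set.mem_singleton_iff,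
        Set.ext_iff, Finset.ext_iff, Set.mem_traceOn, Finset.mem_subtype, Set.mem_inter_iff,
        Finset.mem_coe, Subtype.forall]
      refine forall_congr' fun x => ⟨fun h hx => ?_, fun h => ⟨fun hx => ?_, fun hx => ?_⟩⟩
      · rw [← h]; exact (and_iff_left hx).symm
      · exact (h hx.2).1 hx.1
      · exact ⟨(h (hC hx)).2 hx, hC hx⟩
    rw [e, variance_condExp_indicator (cylSigma_le F) (measurableSet_traceEvent K _)]
    -- For a single trace the constant is `min 1 2 = 1`.
    have := sum_integral_condExp_sub_sq_le H hFK {C.subtype fun x => x ∈ K}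
    simpa using this
  · have hsigma : cylSigma (K : Set E) =
        MeasurableSpace.comap (Set.traceOn ((↑) : K → E)) ⊤ := by
      rw [← cylSigma_range, Subtype.range_coe]
    rw [hsigma] at hA₁
    obtain ⟨𝒮, -, rfl⟩ := hA₁
    set 𝒞 : Finset (Finset K) := 𝒮.toFinite.toFinset
    have hA₂' : MeasurableSet A₂ := cylSigma_le F _ hA₂
    have h1 : ∀ μ : Measure (Set E), [IsFiniteMeasure μ] →
        μ.real (Set.traceOn ((↑) : K → E) ⁻¹' 𝒮) = ∑ C ∈ 𝒞, μ.real (traceEvent K C) := by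
      intro μ _
      rw [← 𝒮.toFinite.coe_toFinset]
      exact (sum_measureReal_preimage_singleton _ fun C _ => measurableSet_traceEvent K C).symm
    have h2 : (detMeasure H).real (Set.traceOn ((↑) : K → E) ⁻¹' 𝒮 ∩ A₂) =
        ∑ C ∈ 𝒞, (detMeasure H).real (traceEvent K C ∩ A₂) := by
      rw [← measureReal_restrict_apply' hA₂', h1]
      exact Finset.sum_congr rfl fun C _ => measureReal_restrict_apply' hA₂'
    rw [h2, h1, Finset.sum_mul, ← Finset.sum_sub_distrib]
    refine (abs_sum_measureReal_inter_sub_mul_le (cylSigma_le F) hA₂ 𝒞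
      (measurableSet_traceEvent K)).trans ?_
    have hcard : (𝒞.card : ℝ) ≤ 2 ^ K.card := by
      have := Finset.card_le_univ 𝒞
      rw [Fintype.card_finset, Fintype.card_coe] at this
      exact_mod_cast this
    -- The branch `2` of the minimum is used: the branch `𝒞.card` would give `2^|K|` a second time.
    have h3 : ∑ C ∈ 𝒞, ∫ S, (((detMeasure H)⟦traceEvent K C | cylSigma F⟧) S -
        (detMeasure H).real (traceEvent K C)) ^ 2 ∂(detMeasure H) ≤ 2 * (K.card * V) :=
      (sum_integral_condExp_sub_sq_le H hFK 𝒞).trans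
        (mul_le_mul_of_nonneg_right (min_le_right _ _) (by positivity))
    have h4 := mul_le_mul hcard h3 (Finset.sum_nonneg fun C _ =>
      integral_nonneg fun S => sq_nonneg _) (by positivity)
    -- The factor `2` under the root is absorbed by the halving outside it, as `2 ≤ 2 ^ 2`.
    rw [div_le_iff₀ two_pos]
    refine (Real.sqrt_le_sqrt (h4.trans (?_ : _ ≤ (2 ^ K.card * K.card * V) * 2 ^ 2))).trans_eq ?_
    · have : 0 ≤ (2 : ℝ) ^ K.card * K.card * V := by positivity
      linarith
    · rw [Real.sqrt_mul' _ (by positivity), Real.sqrt_sq two_pos.le]
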